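/- Let $\hbar\in\mathbb{R}$, $\hbar\neq 0$, and let $\mathfrak{A}$ be the unital associative complex algebra generated by $J_+,J_-,J_3$ with $[J_-,J_+]=2\imath\hbar J_3$ and $[J_3,J_\pm]=\pm\imath\hbar J_\pm$ (the enveloping algebra of $\mathfrak{sl}(2,\mathbb{R})$), with Casimir $C=J_3^2-\tfrac12(J_+J_-+J_-J_+)$ and the primitive coproduct. For a nonempty $A\subseteq[n]:=\{1,\dots,n\}$ let $C_A\in\mathfrak{A}^{\otimes n}$ be the image of $C$ under the algebra morphism $\mathfrak{A}\to\mathfrak{A}^{\otimes n}$, $J_\sigma\mapsto\sum_{i\in A}J_\sigma^{(i)}$, where $J_\sigma^{(i)}$ is $J_\sigma$ at site $i$. The Racah algebra $R(n)$ is the subalgebra of $\mathfrak{A}^{\otimes n}$ generated by all the $C_A$; $R(3)$ is the rank one Racah algebra. Let $a=(a_1,\dots,a_n)$ be arbitrary real parameters. Consider families, indexed by $a\in\mathbb{R}^n$ and multiplied pointwise in $a$, of linear operators on the complex-valued smooth functions on $\{x\in\mathbb{R}^n: x_i\ne0 \text{ for all } i\}$, and put $\hat p_i=-\imath\hbar\partial_{x_i}$,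 $\hat L_{ij}=x_i\hat p_j-x_j\hat p_i$, $$\hat C_i=\tfrac1{16}(3\hbar^2-4a_i),\qquad \hat C_{ij}=-\tfrac14\Bigl(\hat L_{ij}^2+a_i\tfrac{x_j^2}{x_i^2}+a_j\tfrac{x_i^2}{x_j^2}+a_i+a_j-\hbar^2\Bigr),$$ $$\hat{\mathcal L}_m=\sum_{1\le i<j\le m}\hat C_{ij}-(m-2)\sum_{i=1}^m\hat C_i,\qquad \hat{\mathcal R}_m=\sum_{m\le i<j\le n}\hat C_{ij}-(n-m-1)\sum_{i=m}^n\hat C_i ,$$ $$\hat{\mathcal M}_k=\hat{\mathcal L}_n-\hat{\mathcal L}_k-\hat{\mathcal R}_k+\hat{\mathcal L}_{k-1}+\hat C_k+\hat{\mathcal R}_{k+1}.$$ Let $S^{(\hbar)}_{(n,k)}$ be the complex algebra generated by $\hat{\mathcal L}_{k-1},\hat C_k,\hat{\mathcal R}_{k+1},\hat{\mathcal L}_k,\hat{\mathcal R}_k,\hat{\mathcal M}_k,\hat{\mathcal L}_n$. Proposition. Let $n>3$. There is an algebra morphism $\rho$ from $\mathfrak{A}^{\otimes n}$ to the algebra of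 these families of operators with $$\rho(J_+^{(i)})=\tfrac12\Bigl(-\hbar^2\partial_{x_i}^2+\tfrac{a_i}{x_i^2}\Bigr),\quad \rho(J_-^{(i)})=\tfrac12x_i^2,\quad \rho(J_3^{(i)})=-\tfrac{\imath\hbar}{2}\bigl(x_i\partial_{x_i}+\tfrac12\bigr)\qquad(1\le i\le n),$$ such that the following holds for each $k=2,\dots,n-1$. Let $K_1=\{1,\dots,k-1\}$, $K_2=\{k\}$, $K_3=\{k+1,\dots,n\}$, and $K_B=\bigcup_{q\in B}K_q$ for $B\subseteq\{1,2,3\}$. 1. There is an injective algebra morphism $\theta_k:R(3)\to R(n)$ with $\theta_k(C_B)=C_{K_B}$ for every nonempty $B\subseteq\{1,2,3\}$. 2. Under $\rho$, the elements $\theta_k(C_1),\theta_k(C_2),\theta_k(C_3),\theta_k(C_{12}),\theta_k(C_{23}),\theta_k(C_{13}),\theta_k(C_{123})$ become $\hat{\mathcal L}_{k-1},\hat C_k,\hat{\mathcal R}_{k+1},\hat{\mathcal L}_k,\hat{\mathcal R}_k,\hat{\mathcal M}_k,\hat{\mathcal L}_n$ respectively; moreover $\hat{\mathcal L}_n=\hat{\mathcal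 R}_1$, and $\rho(\theta_k(R(3)))=S^{(\hbar)}_{(n,k)}$. 3. $\hat{\mathcal L}_{k-1},\hat C_k,\hat{\mathcal R}_{k+1},\hat{\mathcal L}_n$ commute with all the generators of $S^{(\hbar)}_{(n,k)}$; $\hat{\mathcal L}_n=\hat{\mathcal L}_k+\hat{\mathcal R}_k+\hat{\mathcal M}_k-\hat{\mathcal L}_{k-1}-\hat C_k-\hat{\mathcal R}_{k+1}$; and with $$\hat{\mathcal F}_k:=\tfrac1{2\imath\hbar}[\hat{\mathcal L}_k,\hat{\mathcal R}_k]=\tfrac1{2\imath\hbar}[\hat{\mathcal R}_k,\hat{\mathcal M}_k]=\tfrac1{2\imath\hbar}[\hat{\mathcal M}_k,\hat{\mathcal L}_k]$$ one has $$[\hat{\mathcal L}_k,\hat{\mathcal F}_k]/\imath\hbar=\hat{\mathcal R}_k\hat{\mathcal L}_k-\hat{\mathcal L}_k\hat{\mathcal M}_k+(\hat C_k-\hat{\mathcal L}_{k-1})(\hat{\mathcal R}_{k+1}-\hat{\mathcal L}_n),$$ $$[\hat{\mathcal R}_k,\hat{\mathcal F}_k]/\imath\hbar=\hat{\mathcal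 M}_k\hat{\mathcal R}_k-\hat{\mathcal R}_k\hat{\mathcal L}_k+(\hat{\mathcal R}_{k+1}-\hat C_k)(\hat{\mathcal L}_{k-1}-\hat{\mathcal L}_n),$$ $$[\hat{\mathcal M}_k,\hat{\mathcal F}_k]/\imath\hbar=\hat{\mathcal L}_k\hat{\mathcal M}_k-\hat{\mathcal M}_k\hat{\mathcal R}_k+(\hat{\mathcal L}_{k-1}-\hat{\mathcal R}_{k+1})(\hat C_k-\hat{\mathcal L}_n),$$ $$[\hat{\mathcal R}_k,\hat{\mathcal L}_k+\hat{\mathcal M}_k]=[\hat{\mathcal L}_k,\hat{\mathcal M}_k+\hat{\mathcal R}_k]=[\hat{\mathcal M}_k,\hat{\mathcal L}_k+\hat{\mathcal R}_k]=0,$$ $$[\hat{\mathcal L}_k,\hat{\mathcal F}_k]+[\hat{\mathcal R}_k,\hat{\mathcal F}_k]+[\hat{\mathcal M}_k,\hat{\mathcal F}_k]=0,$$ and, with $\{A,B\}=AB+BA$ and $T_k=\hat{\mathcal L}_n+\hat{\mathcal L}_{k-1}+\hat C_k+\hat{\mathcal R}_{k+1}$, $$[\hat{\mathcal L}_k,\hat{\mathcal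 F}_k]/\imath\hbar=\hat{\mathcal L}_k^2+\{\hat{\mathcal R}_k,\hat{\mathcal L}_k\}-T_k\hat{\mathcal L}_k+(\hat C_k-\hat{\mathcal L}_{k-1})(\hat{\mathcal R}_{k+1}-\hat{\mathcal L}_n),$$ $$[\hat{\mathcal R}_k,\hat{\mathcal F}_k]/\imath\hbar=-\hat{\mathcal R}_k^2-\{\hat{\mathcal L}_k,\hat{\mathcal R}_k\}+T_k\hat{\mathcal R}_k+(\hat{\mathcal R}_{k+1}-\hat C_k)(\hat{\mathcal L}_{k-1}-\hat{\mathcal L}_n).$$ 4. $S^{(\hbar)}_{(n,k)}$ is isomorphic, as a complex algebra, to the rank one Racah algebra $R(3)$, by $\rho\circ\theta_k$. -/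

import Mathlib

open scoped TensorProduct ContDiff

noncomputable section

namespace RacahSub

/-! ### The algebra `𝔄`, its tensor powers, and the Racah algebra `R(n)` -/

/-- Labels of the generators `J₊`, `J₋`, `J₃`. -/
inductive Gen : Type
  | plus
  | minus
  | three

/-- The commutation rules `[J₋, J₊] = 2iħ J₃`, `[J₃, J₊] = iħ J₊`, `[J₃, J₋] = -iħ J₋`. -/
inductive SlRel (ħ : ℝ) : FreeAlgebra ℂ Gen → FreeAlgebra ℂ Gen → Prop
  | minus_plus : SlRel ħ
      (FreeAlgebra.ι ℂ Gen.minus * FreeAlgebra.ι ℂ Gen.plus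
        - FreeAlgebra.ι ℂ Gen.plus * FreeAlgebra.ι ℂ Gen.minus)
      ((2 * Complex.I * (ħ : ℂ)) • FreeAlgebra.ι ℂ Gen.three)
  | three_plus : SlRel ħ
      (FreeAlgebra.ι ℂ Gen.three * FreeAlgebra.ι ℂ Gen.plus
        - FreeAlgebra.ι ℂ Gen.plus * FreeAlgebra.ι ℂ Gen.three)
      ((Complex.I * (ħ : ℂ)) • FreeAlgebra.ι ℂ Gen.plus)
  | three_minus : SlRel ħ
      (FreeAlgebra.ι ℂ Gen.three * FreeAlgebra.ι ℂ Gen.minus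
        - FreeAlgebra.ι ℂ Gen.minus * FreeAlgebra.ι ℂ Gen.three)
      (-((Complex.I * (ħ : ℂ)) • FreeAlgebra.ι ℂ Gen.minus))

/-- The unital associative complex algebra `𝔄` generated by `J₊, J₋, J₃` subject to the
commutation rules `SlRel`: the (complexified) enveloping algebra of `sl(2, ℝ)`, in the basis
rescaled by `ħ`. -/
abbrev Alg (ħ : ℝ) : Type := RingQuot (SlRel ħ)

/-- The generators `J₊, J₋, J₃` of `𝔄`. -/
def J (ħ : ℝ) (σ : Gen) : Alg ħ := RingQuot.mkAlgHom ℂ (SlRel ħ) (FreeAlgebra.ι ℂ σ)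

/-- The Casimir `J₃² - (J₊ J₋ + J₋ J₊) / 2` of `𝔄`. -/
def casimir (ħ : ℝ) : Alg ħ :=
  J ħ .three ^ 2 - (1 / 2 : ℂ) • (J ħ .plus * J ħ .minus + J ħ .minus * J ħ .plus)

/-- The `n`-fold tensor power `𝔄 ⊗ ⋯ ⊗ 𝔄`. The sites `1, …, n` of the chain are indexed by
`Fin n`, site `i + 1` being the element `i`. -/
def Chain (ħ : ℝ) (n : ℕ) : Type := ⨂[ℂ] _ : Fin n, Alg ħ

instance (ħ : ℝ) (n : ℕ) : Ring (Chain ħ n) :=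
  inferInstanceAs (Ring (⨂[ℂ] _ : Fin n, Alg ħ))

instance (ħ : ℝ) (n : ℕ) : Algebra ℂ (Chain ħ n) :=
  inferInstanceAs (Algebra ℂ (⨂[ℂ] _ : Fin n, Alg ħ))

/-- The inclusion `X ↦ 1 ⊗ ⋯ ⊗ X ⊗ ⋯ ⊗ 1` of `𝔄` at a site of the chain. -/
def site (ħ : ℝ) (n : ℕ) (i : Fin n) : Alg ħ →ₐ[ℂ] Chain ħ n :=
  PiTensorProduct.singleAlgHom (R := ℂ) (A := fun _ : Fin n => Alg ħ) i

theorem site_commute (ħ : ℝ) (n : ℕ) {i j : Fin n} (hij : i ≠ j) (x y : Alg ħ) :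
    site ħ n i x * site ħ n j y = site ħ n j y * site ħ n i x := by
  have h := (Pi.mulSingle_commute (f := fun _ : Fin n => Alg ħ) hij x y).eq
  have e : ∀ (f g : Fin n → Alg ħ), PiTensorProduct.tprod ℂ f * PiTensorProduct.tprod ℂ g
      = PiTensorProduct.tprod ℂ (f * g) := fun f g => PiTensorProduct.tprod_mul_tprod f g
  exact (e _ _).trans ((congrArg (PiTensorProduct.tprod ℂ) h).trans (e _ _).symm)

theorem sum_site_comm (ħ : ℝ) (n : ℕ) (A : Finset (Fin n)) (x y : Alg ħ) :
    (∑ i ∈ A, site ħ n i x) * (∑ i ∈ A, site ħ n i y)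
      - (∑ i ∈ A, site ħ n i y) * (∑ i ∈ A, site ħ n i x)
      = ∑ i ∈ A, site ħ n i (x * y - y * x) := by
  have h₂ : (∑ i ∈ A, site ħ n i y) * (∑ i ∈ A, site ħ n i x)
      = ∑ i ∈ A, ∑ j ∈ A, site ħ n j y * site ħ n i x := by
    rw [Finset.sum_mul_sum, Finset.sum_comm]
  rw [Finset.sum_mul_sum, h₂, ← Finset.sum_sub_distrib (s := A)]
  refine Finset.sum_congr rfl fun i hi => ?_
  rw [← Finset.sum_sub_distrib (s := A), Finset.sum_eq_single i]
  · simp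
  · intro j _ hj
    rw [site_commute ħ n hj.symm, sub_self]
  · intro h
    exact absurd hi h

theorem J_rel (ħ : ℝ) :
    J ħ .minus * J ħ .plus - J ħ .plus * J ħ .minus = (2 * Complex.I * (ħ : ℂ)) • J ħ .three ∧
    J ħ .three * J ħ .plus - J ħ .plus * J ħ .three = (Complex.I * (ħ : ℂ)) • J ħ .plus ∧
    J ħ .three * J ħ .minus - J ħ .minus * J ħ .three = -((Complex.I * (ħ : ℂ)) • J ħ .minus) := by
  refine ⟨?_, ?_, ?_⟩
  · simpa [J] using RingQuot.mkAlgHom_rel ℂ (SlRel.minus_plus (ħ := ħ))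
  · simpa [J] using RingQuot.mkAlgHom_rel ℂ (SlRel.three_plus (ħ := ħ))
  · simpa [J] using RingQuot.mkAlgHom_rel ℂ (SlRel.three_minus (ħ := ħ))

/-- The iterated primitive coproduct on the sites in `A`: the algebra morphism `𝔄 → 𝔄 ⊗ ⋯ ⊗ 𝔄`
with `J_σ ↦ ∑_{i ∈ A} J_σ^{(i)}`. For `A = {1, …, m}` and `A = {n-m+1, …, n}` it is the `m`-th
left and right coproduct. -/
def coproduct (ħ : ℝ) (n : ℕ) (A : Finset (Fin n)) : Alg ħ →ₐ[ℂ] Chain ħ n :=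
  RingQuot.liftAlgHom ℂ
    ⟨FreeAlgebra.lift ℂ fun σ => ∑ i ∈ A, site ħ n i (J ħ σ), by
      intro x y h
      cases h with
      | minus_plus =>
        simp only [map_sub, map_mul, map_smul, FreeAlgebra.lift_ι_apply]
        rw [sum_site_comm, (J_rel ħ).1, Finset.smul_sum]
        simp only [map_smul]
      | three_plus =>
        simp only [map_sub, map_mul, map_smul, FreeAlgebra.lift_ι_apply]
        rw [sum_site_comm, (J_rel ħ).2.1, Finset.smul_sum]
        simp only [map_smul]
      | three_minus =>
        simp only [map_sub, map_mul, map_smul, map_neg, FreeAlgebra.lift_ι_apply]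
        rw [sum_site_comm, (J_rel ħ).2.2, Finset.smul_sum]
        simp only [map_smul, map_neg, Finset.sum_neg_distrib]⟩

/-- The intermediate Casimir `C_A`, for a set `A` of sites. -/
def casimirOn (ħ : ℝ) (n : ℕ) (A : Finset (Fin n)) : Chain ħ n := coproduct ħ n A (casimir ħ)

/-- The Racah algebra `R(n)`: the subalgebra of `𝔄 ⊗ ⋯ ⊗ 𝔄` generated by the intermediate Casimirs
`C_A`, for nonempty `A ⊆ {1, …, n}`. -/
def racah (ħ : ℝ) (n : ℕ) : Subalgebra ℂ (Chain ħ n) :=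
  Algebra.adjoin ℂ {c | ∃ A : Finset (Fin n), A.Nonempty ∧ c = casimirOn ħ n A}

/-- The generator `C_A`, as an element of `R(n)`. -/
def racahGen (ħ : ℝ) (n : ℕ) (A : Finset (Fin n)) (hA : A.Nonempty) : racah ħ n :=
  ⟨casimirOn ħ n A, Algebra.subset_adjoin ⟨A, hA, rfl⟩⟩

/-- The three subsets `{1, …, k-1}`, `{k}`, `{k+1, …, n}` of `{1, …, n}`. -/
def block (n k : ℕ) : Fin 3 → Finset (Fin n) :=
  ![Finset.univ.filter fun i => (i : ℕ) + 1 < k,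
    Finset.univ.filter fun i => (i : ℕ) + 1 = k,
    Finset.univ.filter fun i => k < (i : ℕ) + 1]

/-! ### Differential operators -/

/-- The points of `ℝⁿ` off the coordinate hyperplanes, where the coefficients `1 / x_i²` are
defined. -/
def regularSet (n : ℕ) : Set (Fin n → ℝ) := {x | ∀ i, x i ≠ 0}

theorem isOpen_regularSet (n : ℕ) : IsOpen (regularSet n) := by
  have h : regularSet n = ⋂ i : Fin n, {x : Fin n → ℝ | x i ≠ 0} := by
    ext x
    simp [regularSet]
  rw [h]
  exact isOpen_iInter_of_finite fun i => isOpen_ne_fun (continuous_apply i) continuous_const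

/-- The complex-valued smooth functions on `regularSet n`, extended by zero. -/
def Smooth (n : ℕ) : Submodule ℂ ((Fin n → ℝ) → ℂ) where
  carrier := {f | ContDiffOn ℝ ∞ f (regularSet n) ∧ ∀ x ∉ regularSet n, f x = 0}
  add_mem' := by
    rintro f g ⟨hf, hf0⟩ ⟨hg, hg0⟩
    exact ⟨hf.add hg, fun x hx => by simp [hf0 x hx, hg0 x hx]⟩
  zero_mem' := ⟨contDiffOn_const, fun _ _ => rfl⟩
  smul_mem' := by
    rintro c f ⟨hf, hf0⟩
    exact ⟨contDiffOn_const.smul hf, fun x hx => by simp [hf0 x hx]⟩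

/-- Linear operators on the smooth functions. -/
abbrev Op (n : ℕ) : Type := Module.End ℂ (Smooth n)

/-- Multiplication by a function that is smooth on `regularSet n`. -/
def mulOp (n : ℕ) (g : (Fin n → ℝ) → ℂ) (hg : ContDiffOn ℝ ∞ g (regularSet n)) : Op n where
  toFun f := ⟨fun x => g x * f.1 x, hg.mul f.2.1, fun x hx => by simp [f.2.2 x hx]⟩
  map_add' f g := by
    ext x
    simp [mul_add]
  map_smul' c f := by
    ext x
    simp [mul_left_comm]

theorem contDiffOn_coord (n : ℕ) (i : Fin n) :
    ContDiffOn ℝ ∞ (fun x : Fin n → ℝ => ((x i : ℝ) : ℂ)) (regularSet n) :=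
  (Complex.ofRealCLM.contDiff.comp (contDiff_apply ℝ ℝ i)).contDiffOn

theorem contDiffOn_coord_inv (n : ℕ) (i : Fin n) :
    ContDiffOn ℝ ∞ (fun x : Fin n → ℝ => ((x i : ℝ) : ℂ)⁻¹) (regularSet n) :=
  (contDiffOn_coord n i).inv fun x hx => by exact_mod_cast hx i

/-- Multiplication by the coordinate `x_i`. -/
def X (n : ℕ) (i : Fin n) : Op n := mulOp n _ (contDiffOn_coord n i)

/-- Multiplication by `1 / x_i`. -/
def Xinv (n : ℕ) (i : Fin n) : Op n := mulOp n _ (contDiffOn_coord_inv n i)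

theorem smooth_differentiableAt {n : ℕ} (f : Smooth n) {x : Fin n → ℝ} (hx : x ∈ regularSet n) :
    DifferentiableAt ℝ f.1 x :=
  (f.2.1.contDiffAt ((isOpen_regularSet n).mem_nhds hx)).differentiableAt (by simp)

open Classical in
/-- The partial derivative `∂ / ∂x_i`. -/
def D (n : ℕ) (i : Fin n) : Op n where
  toFun f := ⟨(regularSet n).indicator fun x => fderiv ℝ f.1 x (Pi.single i 1), by
      have h : ContDiffOn ℝ ∞ (fun x => fderiv ℝ f.1 x (Pi.single i 1)) (regularSet n) :=
        (f.2.1.fderiv_of_isOpen (isOpen_regularSet n) (by simp)).clm_apply contDiffOn_const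
      exact h.congr fun x hx => Set.indicator_of_mem hx _,
    fun x hx => Set.indicator_of_notMem hx _⟩
  map_add' f g := by
    ext x
    by_cases hx : x ∈ regularSet n
    · simp [hx, fderiv_add (smooth_differentiableAt f hx) (smooth_differentiableAt g hx)]
    · simp [hx]
  map_smul' c f := by
    ext x
    by_cases hx : x ∈ regularSet n
    · simp [hx, fderiv_const_smul (smooth_differentiableAt f hx)]
    · simp [hx]

/-- The momentum `p_i = -iħ ∂ / ∂x_i`. -/
def P (ħ : ℝ) (n : ℕ) (i : Fin n) : Op n := (-(Complex.I * (ħ : ℂ))) • D n i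

/-- The one-site differential realisation of `J₊, J₋, J₃` in the variable `x_i`, with parameter
`a_i`. -/
def JOp (ħ : ℝ) {n : ℕ} (a : Fin n → ℝ) (i : Fin n) : Gen → Op n
  | .plus => (1 / 2 : ℂ) • (-((ħ : ℂ) ^ 2 • D n i ^ 2) + (a i : ℂ) • Xinv n i ^ 2)
  | .minus => (1 / 2 : ℂ) • X n i ^ 2
  | .three => (-(Complex.I * (ħ : ℂ) / 2)) • (X n i * D n i + (1 / 2 : ℂ) • 1)

/-- Differential operators depending on the real parameters `a = (a_1, …, a_n)`: families of
operators indexed by `a`, with pointwise operations. The parameters are arbitrary, so an identity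
in this algebra is an identity of operators for every value of `a`. -/
abbrev OpFamily (n : ℕ) : Type := (Fin n → ℝ) → Op n

/-- `ρ` is the `n`-site differential realisation: it sends `J_σ` at the site `i` to `JOp`. -/
def IsRealisation (ħ : ℝ) (n : ℕ) (ρ : Chain ħ n →ₐ[ℂ] OpFamily n) : Prop :=
  ∀ (i : Fin n) (σ : Gen) (a : Fin n → ℝ), ρ (site ħ n i (J ħ σ)) a = JOp ħ a i σ

/-- The operator `Ĉ_i = (3ħ² - 4a_i) / 16`. -/
def C1 (ħ : ℝ) {n : ℕ} (i : Fin n) : OpFamily n :=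
  fun a => ((1 / 16 : ℂ) * (3 * (ħ : ℂ) ^ 2 - 4 * (a i : ℂ))) • 1

/-- The angular momentum `L_ij = x_i p_j - x_j p_i`. -/
def angMom (ħ : ℝ) {n : ℕ} (i j : Fin n) : Op n := X n i * P ħ n j - X n j * P ħ n i

/-- The operator
`Ĉ_ij = -(L_ij² + a_i x_j² / x_i² + a_j x_i² / x_j² + a_i + a_j - ħ²) / 4`. -/
def C2 (ħ : ℝ) {n : ℕ} (i j : Fin n) : OpFamily n :=
  fun a => (-(1 / 4) : ℂ) • (angMom ħ i j ^ 2
    + (a i : ℂ) • (X n j ^ 2 * Xinv n i ^ 2) + (a j : ℂ) • (X n i ^ 2 * Xinv n j ^ 2)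
    + ((a i : ℂ) + (a j : ℂ) - (ħ : ℂ) ^ 2) • 1)

/-- The left Casimir `ℒ_m = ∑_{1 ≤ i < j ≤ m} Ĉ_ij - (m - 2) ∑_{1 ≤ i ≤ m} Ĉ_i`. -/
def leftCas (ħ : ℝ) (n m : ℕ) : OpFamily n :=
  (∑ p : Fin n × Fin n with p.1 < p.2 ∧ (p.2 : ℕ) + 1 ≤ m, C2 ħ p.1 p.2)
    - ((m : ℂ) - 2) • ∑ i ∈ (Finset.univ : Finset (Fin n)) with i.val + 1 ≤ m, C1 ħ i

/-- The right Casimir `ℛ_m = ∑_{m ≤ i < j ≤ n} Ĉ_ij - (n - m + 1 - 2) ∑_{m ≤ i ≤ n} Ĉ_i`. -/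
def rightCas (ħ : ℝ) (n m : ℕ) : OpFamily n :=
  (∑ p : Fin n × Fin n with p.1 < p.2 ∧ m ≤ (p.1 : ℕ) + 1, C2 ħ p.1 p.2)
    - ((n : ℂ) - (m : ℂ) + 1 - 2) • ∑ i ∈ (Finset.univ : Finset (Fin n)) with m ≤ i.val + 1, C1 ħ i

/-- The one-index operator `Ĉ_k` at the site `k`, counted from `1` (for `1 ≤ k ≤ n` the sum has
one term). -/
def siteCas (ħ : ℝ) (n k : ℕ) : OpFamily n := ∑ i ∈ (Finset.univ : Finset (Fin n)) with i.val + 1 = k, C1 ħ i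

/-- `ℳ_k = ℒ_n - ℒ_k - ℛ_k + ℒ_{k-1} + Ĉ_k + ℛ_{k+1}`. -/
def midCas (ħ : ℝ) (n k : ℕ) : OpFamily n :=
  leftCas ħ n n - leftCas ħ n k - rightCas ħ n k + leftCas ħ n (k - 1) + siteCas ħ n k
    + rightCas ħ n (k + 1)

/-- The quantum substructure with index `(n, k)`: the algebra generated by
`ℒ_{k-1}, Ĉ_k, ℛ_{k+1}, ℒ_k, ℛ_k, ℳ_k, ℒ_n`. -/
def substructure (ħ : ℝ) (n k : ℕ) : Subalgebra ℂ (OpFamily n) :=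
  Algebra.adjoin ℂ {leftCas ħ n (k - 1), siteCas ħ n k, rightCas ħ n (k + 1), leftCas ħ n k,
    rightCas ħ n k, midCas ħ n k, leftCas ħ n n}

/-! ### The commutation relations -/

/-- The commutator. -/
def comm {A : Type*} [Ring A] (x y : A) : A := x * y - y * x

/-- The anticommutator. -/
def acomm {A : Type*} [Ring A] (x y : A) : A := x * y + y * x

/-- The rank one Racah relations between elements `C₁, C₂, C₃, C₁₂, C₂₃, C₁₃, C₁₂₃` of an algebra,
with `F = [C₁₂, C₂₃] / (2iħ)`. -/
structure RacahRelations {A : Type*} [Ring A] [Algebra ℂ A] (ħ : ℝ)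
    (c₁ c₂ c₃ c₁₂ c₂₃ c₁₃ c₁₂₃ f : A) : Prop where
  linear : c₁₂₃ = c₁₂ + c₁₃ + c₂₃ - c₁ - c₂ - c₃
  central : ∀ z ∈ ({c₁, c₂, c₃, c₁₂₃} : Set A),
    ∀ g ∈ ({c₁, c₂, c₃, c₁₂, c₂₃, c₁₃, c₁₂₃} : Set A), comm z g = 0
  f_eq₁ : f = (1 / (2 * Complex.I * (ħ : ℂ))) • comm c₁₂ c₂₃
  f_eq₂ : f = (1 / (2 * Complex.I * (ħ : ℂ))) • comm c₂₃ c₁₃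
  f_eq₃ : f = (1 / (2 * Complex.I * (ħ : ℂ))) • comm c₁₃ c₁₂
  comm₁₂ : (1 / (Complex.I * (ħ : ℂ))) • comm c₁₂ f
    = c₂₃ * c₁₂ - c₁₂ * c₁₃ + (c₂ - c₁) * (c₃ - c₁₂₃)
  comm₂₃ : (1 / (Complex.I * (ħ : ℂ))) • comm c₂₃ f
    = c₁₃ * c₂₃ - c₂₃ * c₁₂ + (c₃ - c₂) * (c₁ - c₁₂₃)
  comm₁₃ : (1 / (Complex.I * (ħ : ℂ))) • comm c₁₃ f
    = c₁₂ * c₁₃ - c₁₃ * c₂₃ + (c₁ - c₃) * (c₂ - c₁₂₃)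
  add₂₃ : comm c₂₃ (c₁₂ + c₁₃) = 0
  add₁₂ : comm c₁₂ (c₁₃ + c₂₃) = 0
  add₁₃ : comm c₁₃ (c₁₂ + c₂₃) = 0
  sum_zero : comm c₁₂ f + comm c₂₃ f + comm c₁₃ f = 0
  quad₁₂ : (1 / (Complex.I * (ħ : ℂ))) • comm c₁₂ f
    = c₁₂ ^ 2 + acomm c₂₃ c₁₂ - (c₁₂₃ + c₁ + c₂ + c₃) * c₁₂ + (c₂ - c₁) * (c₃ - c₁₂₃)
  quad₂₃ : (1 / (Complex.I * (ħ : ℂ))) • comm c₂₃ f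
    = -c₂₃ ^ 2 - acomm c₁₂ c₂₃ + (c₁₂₃ + c₁ + c₂ + c₃) * c₂₃ + (c₃ - c₂) * (c₁ - c₁₂₃)

end RacahSub

end

noncomputable section

namespace RacahSub

/-! ### Morphisms out of `𝔄` and out of its tensor powers -/

/-! The Casimir `casOf` is a quadratic form in a triple of generators, and `dotOf` is its
polarisation. For three commuting triples `t`, `u`, `v` the linear Racah relation is the
polarisation identity, and centrality holds because a Casimir commutes with its own triple and with
every triple that commutes with it. For the cubic relations put `A = casOf (t + u)`. Since `A`
commutes with `casOf u`, `casOf v` and all `v σ`, the double commutator of `A` with `casOf (u + v)`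
is the double commutator with `u`, contracted with `v`. This in turn is a quantum version of a
vector triple product (`comm_comm_dotOf`). The remaining relations are formal consequences
(`racahRelations_of_comm`).

A quadratic form on a sum is determined by its values on single terms and on pairs (`casOf_sum`).
The one-site and two-site Casimirs of the realisation are computed directly in a Weyl algebra, and
this identifies the left and right Casimirs; the linear relation then identifies `midCas`.

The morphism `theta` applies the iterated coproduct of each block. It is injective because keeping
one site per block and applying the counit elsewhere undoes it (`blockHom_injective`).

The isomorphism rests on the injectivity of the realisation on the whole chain
(`realisation_injective`). Ordered monomials in the generators span, and their images, applied to
products of powers of the coordinates, are linearly independent functions of the exponents, the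
points and the parameters. Letting the parameters vary is essential: for a fixed `a` the Casimir of
each site acts as a scalar. The Poincaré–Birkhoff–Witt theorem is not needed, since independence is
checked on the operators. -/

theorem prod_ofFn_mul {B : Type*} [Monoid B] {n : ℕ} (f g : Fin n → B)
    (h : ∀ i j, i ≠ j → Commute (f i) (g j)) :
    (List.ofFn (f * g)).prod = (List.ofFn f).prod * (List.ofFn g).prod := by
  induction n with
  | zero => simp
  | succ n ih =>
    have hc : Commute (g 0) (List.ofFn fun i : Fin n => f i.succ).prod := by
      refine Commute.list_prod_right _ _ fun x hx => ?_
      obtain ⟨i, rfl⟩ := (List.mem_ofFn' _ _).1 hx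
      exact (h i.succ 0 (Fin.succ_ne_zero i)).symm
    have ih' := ih (fun i => f i.succ) (fun i => g i.succ)
      fun i j hij => h _ _ fun e => hij (Fin.succ_injective _ e)
    simp only [List.ofFn_succ, List.prod_cons, Pi.mul_apply] at ih' ⊢
    have e : (List.ofFn fun i : Fin n => f i.succ * g i.succ).prod = _ := ih'
    -- The only reordering needed is `g 0` past the tail of the `f`'s.
    rw [e, mul_assoc, mul_assoc, ← mul_assoc (g 0), hc.eq, mul_assoc]

theorem prod_ofFn_mulSingle {B : Type*} [Monoid B] {n : ℕ} (i : Fin n) (b : B) (f : Fin n → B)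
    (hi : f i = b) (hf : ∀ j, j ≠ i → f j = 1) : (List.ofFn f).prod = b := by
  induction n with
  | zero => exact i.elim0
  | succ n ih =>
    rw [List.ofFn_succ, List.prod_cons]
    induction i using Fin.cases with
    | zero =>
      have : (fun j : Fin n => f j.succ) = fun _ => 1 :=
        funext fun j => hf _ (Fin.succ_ne_zero j)
      rw [this, hi]
      simp
    | succ i =>
      rw [hf 0 (Fin.succ_ne_zero i).symm, one_mul]
      exact ih i (fun j => f j.succ) hi fun j hj => hf _ fun e => hj (Fin.succ_injective _ e)

/-- The morphism on the chain that combines pairwise commuting morphisms on the sites. -/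
def chainLift {ħ : ℝ} {n : ℕ} {B : Type*} [Ring B] [Algebra ℂ B] (φ : Fin n → Alg ħ →ₐ[ℂ] B)
    (hφ : ∀ i j, i ≠ j → ∀ x y, Commute (φ i x) (φ j y)) : Chain ħ n →ₐ[ℂ] B :=
  PiTensorProduct.liftAlgHom (R := ℂ) (A := fun _ : Fin n => Alg ħ)
    ((MultilinearMap.mkPiAlgebraFin ℂ n B).compLinearMap fun i => (φ i).toLinearMap)
    (by simp)
    (fun x y => by
      simp only [MultilinearMap.compLinearMap_apply, MultilinearMap.mkPiAlgebraFin_apply,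
        AlgHom.toLinearMap_apply]
      rw [← prod_ofFn_mul _ _ fun i j hij => hφ i j hij _ _]
      congr 2
      ext i
      simp)

/-- The pure tensors of the chain. -/
def pureTensor (ħ : ℝ) {n : ℕ} (x : Fin n → Alg ħ) : Chain ħ n := PiTensorProduct.tprod ℂ x

theorem chainLift_pureTensor {ħ : ℝ} {n : ℕ} {B : Type*} [Ring B] [Algebra ℂ B]
    (φ : Fin n → Alg ħ →ₐ[ℂ] B) (hφ : ∀ i j, i ≠ j → ∀ x y, Commute (φ i x) (φ j y))
    (x : Fin n → Alg ħ) :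
    chainLift φ hφ (pureTensor ħ x) = (List.ofFn fun i => φ i (x i)).prod :=
  (PiTensorProduct.lift.tprod (R := ℂ) (s := fun _ : Fin n => Alg ħ) x).trans (by simp)

theorem site_eq_pureTensor (ħ : ℝ) (n : ℕ) (i : Fin n) (x : Alg ħ) :
    site ħ n i x = pureTensor ħ (Pi.mulSingle i x) := rfl

theorem chainLift_site {ħ : ℝ} {n : ℕ} {B : Type*} [Ring B] [Algebra ℂ B]
    (φ : Fin n → Alg ħ →ₐ[ℂ] B) (hφ : ∀ i j, i ≠ j → ∀ x y, Commute (φ i x) (φ j y))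
    (i : Fin n) (x : Alg ħ) : chainLift φ hφ (site ħ n i x) = φ i x := by
  rw [site_eq_pureTensor, chainLift_pureTensor]
  refine prod_ofFn_mulSingle i _ _ (by simp) fun j hj => ?_
  rw [Pi.mulSingle_eq_of_ne hj, map_one]

theorem alg_hom_ext {ħ : ℝ} {B : Type*} [Semiring B] [Algebra ℂ B] {f g : Alg ħ →ₐ[ℂ] B}
    (h : ∀ σ, f (J ħ σ) = g (J ħ σ)) : f = g := by
  exact RingQuot.ringQuot_ext' ℂ f g (FreeAlgebra.hom_ext (funext fun σ => h σ))

theorem chain_hom_ext {ħ : ℝ} {n : ℕ} {B : Type*} [Semiring B] [Algebra ℂ B]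
    {f g : Chain ħ n →ₐ[ℂ] B} (h : ∀ i σ, f (site ħ n i (J ħ σ)) = g (site ħ n i (J ħ σ))) :
    f = g :=
  PiTensorProduct.algHom_ext (R := ℂ) (A := fun _ : Fin n => Alg ħ) fun i =>
    alg_hom_ext (f := f.comp (site ħ n i)) (g := g.comp (site ħ n i)) fun σ => h i σ

/-- `𝔄` is generated by `J₊, J₋, J₃`. -/
theorem alg_adjoin_J (ħ : ℝ) : Algebra.adjoin ℂ (Set.range (J ħ)) = ⊤ := by
  have h : Set.range (J ħ) = RingQuot.mkAlgHom ℂ (SlRel ħ) '' Set.range (FreeAlgebra.ι ℂ) := by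
    rw [← Set.range_comp]
    rfl
  rw [h, ← AlgHom.map_adjoin, FreeAlgebra.adjoin_range_ι, Algebra.map_top,
    AlgHom.range_eq_top]
  exact RingQuot.mkAlgHom_surjective ℂ _

/-- The defining commutation rules, for three elements of an algebra. -/
structure SlTriple {B : Type*} [Ring B] [Algebra ℂ B] (ħ : ℝ) (t : Gen → B) : Prop where
  minus_plus : t .minus * t .plus - t .plus * t .minus = (2 * Complex.I * (ħ : ℂ)) • t .three
  three_plus : t .three * t .plus - t .plus * t .three = (Complex.I * (ħ : ℂ)) • t .plus
  three_minus : t .three * t .minus - t .minus * t .three = -((Complex.I * (ħ : ℂ)) • t .minus)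

/-- The morphism on `𝔄` given by three elements that satisfy the commutation rules. -/
def SlTriple.lift {B : Type*} [Ring B] [Algebra ℂ B] {ħ : ℝ} {t : Gen → B} (h : SlTriple ħ t) :
    Alg ħ →ₐ[ℂ] B :=
  RingQuot.liftAlgHom ℂ
    ⟨FreeAlgebra.lift ℂ t, by
      intro x y hxy
      cases hxy with
      | minus_plus => simpa using h.minus_plus
      | three_plus => simpa using h.three_plus
      | three_minus => simpa using h.three_minus⟩

theorem SlTriple.lift_J {B : Type*} [Ring B] [Algebra ℂ B] {ħ : ℝ} {t : Gen → B}
    (h : SlTriple ħ t) (σ : Gen) : h.lift (J ħ σ) = t σ := by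
  simp [SlTriple.lift, J]

theorem slTriple_J (ħ : ℝ) : SlTriple ħ (J ħ) :=
  ⟨(J_rel ħ).1, (J_rel ħ).2.1, (J_rel ħ).2.2⟩

theorem SlTriple.map {B B' : Type*} [Ring B] [Algebra ℂ B] [Ring B'] [Algebra ℂ B'] {ħ : ℝ}
    {t : Gen → B} (h : SlTriple ħ t) (f : B →ₐ[ℂ] B') : SlTriple ħ fun σ => f (t σ) := by
  refine ⟨?_, ?_, ?_⟩
  · simpa using congrArg f h.minus_plus
  · simpa using congrArg f h.three_plus
  · simpa using congrArg f h.three_minus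

/-- The centraliser of `b` is a subalgebra, so generators suffice. -/
theorem commute_of_generators {ħ : ℝ} {B : Type*} [Ring B] [Algebra ℂ B] (f : Alg ħ →ₐ[ℂ] B)
    (b : B) (h : ∀ σ, Commute (f (J ħ σ)) b) (x : Alg ħ) : Commute (f x) b := by
  have hx : x ∈ Algebra.adjoin ℂ (Set.range (J ħ)) := by rw [alg_adjoin_J]; trivial
  induction hx using Algebra.adjoin_induction with
  | mem x hx => obtain ⟨σ, rfl⟩ := hx; exact h σ
  | algebraMap r => rw [AlgHom.commutes]; exact Algebra.commutes r b
  | add x y _ _ hx hy => rw [map_add]; exact hx.add_left hy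
  | mul x y _ _ hx hy => rw [map_mul]; exact hx.mul_left hy

theorem commute_of_generators₂ {ħ : ℝ} {B : Type*} [Ring B] [Algebra ℂ B] (f g : Alg ħ →ₐ[ℂ] B)
    (h : ∀ σ τ, Commute (f (J ħ σ)) (g (J ħ τ))) (x y : Alg ħ) : Commute (f x) (g y) :=
  commute_of_generators f _
    (fun σ => (commute_of_generators g _ (fun τ => (h σ τ).symm) y).symm) x

/-- The counit of `𝔄`. -/
def counit (ħ : ℝ) : Alg ħ →ₐ[ℂ] ℂ :=
  SlTriple.lift (ħ := ħ) (t := fun _ => (0 : ℂ)) ⟨by simp, by simp, by simp⟩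

theorem counit_J (ħ : ℝ) (σ : Gen) : counit ħ (J ħ σ) = 0 := SlTriple.lift_J _ σ

theorem coproduct_J (ħ : ℝ) (n : ℕ) (A : Finset (Fin n)) (σ : Gen) :
    coproduct ħ n A (J ħ σ) = ∑ i ∈ A, site ħ n i (J ħ σ) := by
  simp [coproduct, J]

theorem coproduct_commute (ħ : ℝ) (n : ℕ) {A A' : Finset (Fin n)} (h : Disjoint A A')
    (x y : Alg ħ) : Commute (coproduct ħ n A x) (coproduct ħ n A' y) := by
  refine commute_of_generators₂ _ _ (fun σ τ => ?_) x y
  rw [coproduct_J, coproduct_J]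
  refine Commute.sum_left _ _ _ fun i hi => Commute.sum_right _ _ _ fun j hj => ?_
  exact site_commute ħ n (fun e : i = j => Finset.disjoint_left.1 h hi (e ▸ hj)) _ _

/-! ### The morphism `θ` -/

section Theta

variable {ħ : ℝ} {m n : ℕ} (K : Fin m → Finset (Fin n))
  (hK : ∀ p q, p ≠ q → Disjoint (K p) (K q))

/-- The morphism that applies, at each site `q`, the iterated coproduct on the sites in `K q`. -/
def blockHom (ħ : ℝ) : Chain ħ m →ₐ[ℂ] Chain ħ n :=
  chainLift (fun q => coproduct ħ n (K q)) fun p q h => coproduct_commute ħ n (hK p q h)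

/-- This is coassociativity. Both sides are morphisms on `𝔄`, and on a generator the sum over the
union splits into sums over the blocks because the blocks are disjoint. -/
theorem blockHom_coproduct (B : Finset (Fin m)) (x : Alg ħ) :
    blockHom K hK ħ (coproduct ħ m B x) = coproduct ħ n (B.biUnion K) x := by
  have h : (blockHom K hK ħ).comp (coproduct ħ m B) = coproduct ħ n (B.biUnion K) := by
    refine alg_hom_ext fun σ => ?_
    rw [AlgHom.comp_apply, coproduct_J, coproduct_J, map_sum,
      Finset.sum_biUnion fun p _ q _ h => hK p q h]
    exact Finset.sum_congr rfl fun q _ => (chainLift_site _ _ _ _).trans (coproduct_J _ _ _ _)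
  exact DFunLike.congr_fun h x

theorem blockHom_casimirOn (B : Finset (Fin m)) :
    blockHom K hK ħ (casimirOn ħ m B) = casimirOn ħ n (B.biUnion K) :=
  blockHom_coproduct K hK B _

/-- Choosing a site in each block and applying the counit to all the others gives a left inverse. -/
theorem blockHom_injective (hne : ∀ q, (K q).Nonempty) :
    Function.Injective (blockHom K hK ħ) := by
  classical
  choose r hr using hne
  have hrK : ∀ p q, r p ∈ K q → p = q := fun p q h => by
    by_contra hpq
    exact Finset.disjoint_left.1 (hK p q hpq) (hr p) h
  -- The chosen site `r q` is sent back to site `q`; every other site is collapsed by the counit.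
  let φ : Fin n → Alg ħ →ₐ[ℂ] Chain ħ m := fun i =>
    if h : ∃ q, r q = i then site ħ m h.choose else (Algebra.ofId ℂ (Chain ħ m)).comp (counit ħ)
  have hφr : ∀ q, φ (r q) = site ħ m q := fun q => by
    have h : ∃ q', r q' = r q := ⟨q, rfl⟩
    have e : h.choose = q := hrK _ _ (by rw [h.choose_spec]; exact hr q)
    simp only [φ, dif_pos h, e]
  have hφ0 : ∀ i, (∀ q, r q ≠ i) → φ i = (Algebra.ofId ℂ (Chain ħ m)).comp (counit ħ) :=
    fun i h => dif_neg fun ⟨q, hq⟩ => h q hq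
  have hφ : ∀ i j, i ≠ j → ∀ x y, Commute (φ i x) (φ j y) := by
    intro i j hij x y
    by_cases hi : ∃ q, r q = i
    · by_cases hj : ∃ q, r q = j
      · obtain ⟨p, rfl⟩ := hi
        obtain ⟨q, rfl⟩ := hj
        rw [hφr, hφr]
        exact site_commute ħ m (fun e : p = q => hij (e ▸ rfl)) x y
      · rw [hφ0 j fun q h => hj ⟨q, h⟩]
        exact Algebra.commute_algebraMap_right (counit ħ y) (φ i x)
    · rw [hφ0 i fun q h => hi ⟨q, h⟩]
      exact Algebra.commute_algebraMap_left (counit ħ x) (φ j y)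
  have hinv : (chainLift φ hφ).comp (blockHom K hK ħ) = AlgHom.id ℂ _ := by
    refine chain_hom_ext fun q σ => ?_
    rw [AlgHom.comp_apply, AlgHom.id_apply, blockHom, chainLift_site, coproduct_J, map_sum,
      -- The counit kills the generators, so of the block `K q` only the chosen site contributes.
      Finset.sum_eq_single (r q)]
    · rw [chainLift_site, hφr]
    · intro i hi hiq
      rw [chainLift_site, hφ0 i]
      · simp [counit_J]
      · rintro p rfl
        exact hiq (congrArg r (hrK p q hi))
    · intro h
      exact absurd (hr q) h
  exact Function.LeftInverse.injective (g := chainLift φ hφ) fun x => DFunLike.congr_fun hinv x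

end Theta

/-! ### The rank one Racah relations for three commuting triples -/

section Relations

variable {B : Type*} [Ring B] [Algebra ℂ B] {ħ : ℝ}

/-- The Casimir of three elements of an algebra. -/
def casOf (t : Gen → B) : B :=
  t .three ^ 2 - (1 / 2 : ℂ) • (t .plus * t .minus + t .minus * t .plus)

/-- The polarisation of the Casimir. -/
def dotOf (t u : Gen → B) : B :=
  t .three * u .three - (1 / 2 : ℂ) • (t .plus * u .minus + t .minus * u .plus)

theorem map_casimir (f : Alg ħ →ₐ[ℂ] B) : f (casimir ħ) = casOf fun σ => f (J ħ σ) := by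
  simp [casimir, casOf]

theorem SlTriple.add {t u : Gen → B} (ht : SlTriple ħ t) (hu : SlTriple ħ u)
    (h : ∀ σ τ, Commute (t σ) (u τ)) : SlTriple ħ (t + u) := by
  have e : ∀ σ τ, (t + u) σ * (t + u) τ - (t + u) τ * (t + u) σ
      = (t σ * t τ - t τ * t σ) + (u σ * u τ - u τ * u σ) := fun σ τ => by
    simp only [Pi.add_apply, mul_add, add_mul, (h σ τ).eq, (h τ σ).eq]
    abel
  refine ⟨?_, ?_, ?_⟩
  · rw [e, ht.minus_plus, hu.minus_plus, Pi.add_apply, smul_add]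
  · rw [e, ht.three_plus, hu.three_plus, Pi.add_apply, smul_add]
  · rw [e, ht.three_minus, hu.three_minus, Pi.add_apply, smul_add, neg_add]

theorem casOf_add {t u : Gen → B} (h : ∀ σ τ, Commute (t σ) (u τ)) :
    casOf (t + u) = casOf t + casOf u + (2 : ℂ) • dotOf t u := by
  simp only [casOf, dotOf, pow_two, Pi.add_apply, mul_add, add_mul, ← (h _ _).eq]
  module

theorem commute_casOf {w : Gen → B} {x : B} (h : ∀ σ, Commute x (w σ)) : Commute x (casOf w) :=
  ((h _).pow_right 2).sub_right
    ((((h _).mul_right (h _)).add_right ((h _).mul_right (h _))).smul_right _)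

theorem commute_dotOf {w w' : Gen → B} {x : B} (h : ∀ σ, Commute x (w σ))
    (h' : ∀ σ, Commute x (w' σ)) : Commute x (dotOf w w') :=
  ((h _).mul_right (h' _)).sub_right
    ((((h _).mul_right (h' _)).add_right ((h _).mul_right (h' _))).smul_right _)

/-- This rule and the next two are oriented as rewriting rules towards the normal order minus,
three, plus. Once both sides of an identity are normally ordered, it is linear and `module` decides
it. -/
theorem SlTriple.plus_minus {t : Gen → B} (ht : SlTriple ħ t) :
    t .plus * t .minus = t .minus * t .plus - (2 * Complex.I * (ħ : ℂ)) • t .three := by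
  rw [← ht.minus_plus]; abel

theorem SlTriple.plus_three {t : Gen → B} (ht : SlTriple ħ t) :
    t .plus * t .three = t .three * t .plus - (Complex.I * (ħ : ℂ)) • t .plus := by
  rw [← ht.three_plus]; abel

theorem SlTriple.three_minus' {t : Gen → B} (ht : SlTriple ħ t) :
    t .three * t .minus = t .minus * t .three - (Complex.I * (ħ : ℂ)) • t .minus := by
  rw [sub_eq_add_neg, ← ht.three_minus]; abel

theorem mul_left_of_eq {B : Type*} [Ring B] {x y z : B} (h : x * y = z) (w : B) : x * (y * w) = z * w := by
  rw [← mul_assoc, h]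

theorem SlTriple.casOf_commute {t : Gen → B} (ht : SlTriple ħ t) (σ : Gen) :
    Commute (casOf t) (t σ) := by
  have h₁ := ht.plus_minus
  have h₂ := ht.plus_three
  have h₃ := ht.three_minus'
  change _ = _
  cases σ <;>
  · simp only [casOf, pow_two, mul_add, add_mul, mul_sub, sub_mul, smul_mul_assoc, mul_smul_comm,
      mul_assoc, h₁, h₂, h₃, mul_left_of_eq h₁, mul_left_of_eq h₂, mul_left_of_eq h₃, smul_sub,
      smul_add]
    try module

/-- The computational core. Classically the bracket of `t · u` with `u` is a multiple of `t × u`,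
and a second bracket gives vector triple products, which expand into `u (t·t)`, `u (t·u)`, `t (u·u)`
and `t (t·u)`. The identity below is this expansion with the operator ordering fixed. -/
theorem comm_comm_dotOf {t u : Gen → B} (ht : SlTriple ħ t) (hu : SlTriple ħ u)
    (h : ∀ σ τ, Commute (t σ) (u τ)) (σ : Gen) :
    comm (dotOf t u) (comm (dotOf t u) (u σ)) = ((Complex.I * (ħ : ℂ)) ^ 2) •
      (casOf t * u σ + u σ * dotOf t u - casOf u * t σ - dotOf t u * t σ) := by
  have h₁ := ht.plus_minus
  have h₂ := ht.plus_three
  have h₃ := ht.three_minus'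
  have k₁ := hu.plus_minus
  have k₂ := hu.plus_three
  have k₃ := hu.three_minus'
  -- The normal form puts all of `t` before all of `u`, each in its own normal order.
  have g : ∀ σ τ, u σ * t τ = t τ * u σ := fun σ τ => (h τ σ).eq.symm
  have g' : ∀ σ τ w, u σ * (t τ * w) = t τ * (u σ * w) := fun σ τ w => by
    rw [← mul_assoc, g, mul_assoc]
  cases σ <;>
  · simp only [casOf, dotOf, comm, pow_two, mul_add, add_mul, mul_sub, sub_mul, smul_mul_assoc,
      mul_smul_comm, mul_assoc, g, g', h₁, mul_left_of_eq h₁, mul_left_of_eq h₂,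
      mul_left_of_eq h₃, k₁, k₂, k₃, mul_left_of_eq k₁, mul_left_of_eq k₂, mul_left_of_eq k₃,
      smul_sub, smul_add]
    module

theorem comm_eq_zero_iff {B : Type*} [Ring B] {x y : B} : comm x y = 0 ↔ Commute x y := sub_eq_zero

/-- The Casimirs of `t` and `u` commute with everything in sight, so bracketing with `casOf (t + u)`
is twice bracketing with `dotOf t u`. The right side is then rewritten so that `casOf (t + u)` takes
the place of the polarisation. -/
theorem comm_comm_casOf_add {t u : Gen → B} (ht : SlTriple ħ t) (hu : SlTriple ħ u)
    (h : ∀ σ τ, Commute (t σ) (u τ)) (σ : Gen) :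
    comm (casOf (t + u)) (comm (casOf (t + u)) (u σ)) = (2 * (Complex.I * (ħ : ℂ)) ^ 2) •
      (u σ * casOf (t + u) - casOf (t + u) * t σ - (casOf u - casOf t) * (t σ + u σ)) := by
  have a₁ : ∀ τ, Commute (casOf t) (t τ) := ht.casOf_commute
  have a₂ : ∀ τ, Commute (casOf t) (u τ) := fun τ => (commute_casOf fun σ => (h σ τ).symm).symm
  have b₁ : ∀ τ, Commute (casOf u) (t τ) := fun τ => (commute_casOf fun σ => h τ σ).symm
  have b₂ : ∀ τ, Commute (casOf u) (u τ) := hu.casOf_commute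
  have a₃ : Commute (casOf t) (dotOf t u) := commute_dotOf a₁ a₂
  have b₃ : Commute (casOf u) (dotOf t u) := commute_dotOf b₁ b₂
  have e : ∀ y, Commute (casOf t) y → Commute (casOf u) y →
      comm (casOf (t + u)) y = (2 : ℂ) • comm (dotOf t u) y := fun y h₁ h₂ => by
    simp only [casOf_add h, comm, add_mul, mul_add, h₁.eq, h₂.eq, smul_mul_assoc, mul_smul_comm]
    module
  have a₄ : Commute (casOf t) (comm (dotOf t u) (u σ)) :=
    (a₃.mul_right (a₂ σ)).sub_right ((a₂ σ).mul_right a₃)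
  have b₄ : Commute (casOf u) (comm (dotOf t u) (u σ)) :=
    (b₃.mul_right (b₂ σ)).sub_right ((b₂ σ).mul_right b₃)
  rw [e _ (a₂ σ) (b₂ σ), e _ (a₄.smul_right _) (b₄.smul_right _)]
  have s : ∀ x y : B, comm x ((2 : ℂ) • y) = (2 : ℂ) • comm x y := fun x y => by
    simp only [comm, smul_mul_assoc, mul_smul_comm, smul_sub]
  rw [s, comm_comm_dotOf ht hu h, casOf_add h]
  simp only [mul_add, add_mul, sub_mul, smul_mul_assoc, mul_smul_comm, (a₂ σ).eq, (b₂ σ).eq]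
  module

/-- Only the polarisation of `u` and `v` survives the first commutator. As `v` commutes with `casOf
(t + u)`, the double commutator acts on the factor `u` alone, and the previous lemma applies
componentwise; contracting with `v` reassembles Casimirs. -/
theorem comm_comm_casOf {t u v : Gen → B} (ht : SlTriple ħ t) (hu : SlTriple ħ u)
    (htu : ∀ σ τ, Commute (t σ) (u τ)) (htv : ∀ σ τ, Commute (t σ) (v τ))
    (huv : ∀ σ τ, Commute (u σ) (v τ)) :
    comm (casOf (t + u)) (comm (casOf (t + u)) (casOf (u + v))) =
      (2 * (Complex.I * (ħ : ℂ)) ^ 2) • (casOf (u + v) * casOf (t + u)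
        - casOf (t + u) * casOf (t + v)
        + (casOf u - casOf t) * (casOf v - casOf (t + u + v))) := by
  have htuv : ∀ σ τ, Commute ((t + u) σ) (v τ) := fun σ τ => (htv σ τ).add_left (huv σ τ)
  have hv : ∀ τ, Commute (casOf (t + u)) (v τ) := fun τ =>
    (commute_casOf fun σ => (htuv σ τ).symm).symm
  have ht' : Commute (casOf (t + u)) (casOf t) := by
    refine (commute_casOf fun σ => ?_).symm
    exact (ht.casOf_commute σ).add_right (commute_casOf fun τ => (htu τ σ).symm).symm
  have hu' : Commute (casOf (t + u)) (casOf u) := by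
    refine (commute_casOf fun σ => ?_).symm
    exact Commute.add_right (commute_casOf fun τ => htu σ τ).symm (hu.casOf_commute σ)
  have hv' : Commute (casOf (t + u)) (casOf v) := commute_casOf hv
  have key := comm_comm_casOf_add ht hu htu
  rw [casOf_add htuv, casOf_add huv, casOf_add htv]
  generalize hA : casOf (t + u) = A at *
  have e : ∀ x y, Commute A y → comm A (x * y) = comm A x * y := fun x y hy => by
    simp only [comm, sub_mul, mul_assoc, hy.eq]
  have l : comm A (comm A (casOf u + casOf v + (2 : ℂ) • dotOf u v))
      = (2 : ℂ) • (comm A (comm A (u .three)) * v .three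
        - (1 / 2 : ℂ) • (comm A (comm A (u .plus)) * v .minus
          + comm A (comm A (u .minus)) * v .plus)) := by
    rw [← e _ _ (hv .three), ← e _ _ (hv .plus), ← e _ _ (hv .minus), ← e _ _ (hv .three),
      ← e _ _ (hv .plus), ← e _ _ (hv .minus)]
    have e₀ : comm A (casOf u + casOf v + (2 : ℂ) • dotOf u v) = (2 : ℂ) • comm A (dotOf u v) := by
      simp only [comm, mul_add, add_mul, hu'.eq, hv'.eq, mul_smul_comm, smul_mul_assoc]
      module
    rw [e₀]
    simp only [comm, dotOf, mul_add, add_mul, mul_sub, sub_mul, mul_smul_comm, smul_mul_assoc]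
    module
  rw [l, key, key, key]
  have hv₂ : ∀ σ, v σ * A = A * v σ := fun σ => (hv σ).eq.symm
  simp only [dotOf, Pi.add_apply, mul_add, add_mul, mul_sub, sub_mul, mul_smul_comm,
    smul_mul_assoc, mul_assoc, hv₂, ← ht'.eq, ← hu'.eq, ← hv'.eq]
  module

/-- By the linear relation `c₁₂ + c₂₃ + c₁₃` is a combination of central elements. Hence the three
commutators agree up to cyclic order, and the commutators with `f` sum to zero. Two double
commutators therefore determine the third, and eliminating `c₁₃` gives the quadratic forms. -/
theorem racahRelations_of_comm {c₁ c₂ c₃ c₁₂ c₂₃ c₁₃ c₁₂₃ : B} (hħ : ħ ≠ 0)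
    (linear : c₁₂₃ = c₁₂ + c₁₃ + c₂₃ - c₁ - c₂ - c₃)
    (central : ∀ z ∈ ({c₁, c₂, c₃, c₁₂₃} : Set B),
      ∀ g ∈ ({c₁, c₂, c₃, c₁₂, c₂₃, c₁₃, c₁₂₃} : Set B), comm z g = 0)
    (comm₁₂ : comm c₁₂ (comm c₁₂ c₂₃) = (2 * (Complex.I * (ħ : ℂ)) ^ 2) •
      (c₂₃ * c₁₂ - c₁₂ * c₁₃ + (c₂ - c₁) * (c₃ - c₁₂₃)))
    (comm₂₃ : comm c₂₃ (comm c₂₃ c₁₃) = (2 * (Complex.I * (ħ : ℂ)) ^ 2) •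
      (c₁₃ * c₂₃ - c₂₃ * c₁₂ + (c₃ - c₂) * (c₁ - c₁₂₃))) :
    RacahRelations ħ c₁ c₂ c₃ c₁₂ c₂₃ c₁₃ c₁₂₃
      ((1 / (2 * Complex.I * (ħ : ℂ))) • comm c₁₂ c₂₃) := by
  have hc : Complex.I * (ħ : ℂ) ≠ 0 := mul_ne_zero Complex.I_ne_zero (by exact_mod_cast hħ)
  have z₁ : ∀ g ∈ ({c₁, c₂, c₃, c₁₂, c₂₃, c₁₃, c₁₂₃} : Set B), c₁ * g = g * c₁ :=
    fun g hg => sub_eq_zero.1 (central c₁ (by simp) g hg)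
  have z₂ : ∀ g ∈ ({c₁, c₂, c₃, c₁₂, c₂₃, c₁₃, c₁₂₃} : Set B), c₂ * g = g * c₂ :=
    fun g hg => sub_eq_zero.1 (central c₂ (by simp) g hg)
  have z₃ : ∀ g ∈ ({c₁, c₂, c₃, c₁₂, c₂₃, c₁₃, c₁₂₃} : Set B), c₃ * g = g * c₃ :=
    fun g hg => sub_eq_zero.1 (central c₃ (by simp) g hg)
  have z₀ : ∀ g ∈ ({c₁, c₂, c₃, c₁₂, c₂₃, c₁₃, c₁₂₃} : Set B), c₁₂₃ * g = g * c₁₂₃ :=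
    fun g hg => sub_eq_zero.1 (central c₁₂₃ (by simp) g hg)
  have h₁₃ : c₁₃ = c₁₂₃ + c₁ + c₂ + c₃ - c₁₂ - c₂₃ := by rw [linear]; abel
  -- commutators with the combination `c₁₂ + c₁₃ + c₂₃` of central elements vanish
  have q₂₃ : comm c₂₃ c₁₃ = comm c₁₂ c₂₃ := by
    have i₀ := z₀ c₂₃ (by simp)
    have i₁ := z₁ c₂₃ (by simp)
    have i₂ := z₂ c₂₃ (by simp)
    have i₃ := z₃ c₂₃ (by simp)
    rw [h₁₃]
    simp only [comm, mul_add, add_mul, mul_sub, sub_mul, i₀, i₁, i₂, i₃]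
    abel
  have q₁₃ : comm c₁₃ c₁₂ = comm c₁₂ c₂₃ := by
    have i₀ := z₀ c₁₂ (by simp)
    have i₁ := z₁ c₁₂ (by simp)
    have i₂ := z₂ c₁₂ (by simp)
    have i₃ := z₃ c₁₂ (by simp)
    rw [h₁₃]
    simp only [comm, mul_add, add_mul, mul_sub, sub_mul, i₀, i₁, i₂, i₃]
    abel
  have s : ∀ (r : ℂ) (x y : B), comm x (r • y) = r • comm x y := fun r x y => by
    simp only [comm, smul_mul_assoc, mul_smul_comm, smul_sub]
  have hcc : (1 / (Complex.I * (ħ : ℂ))) * ((1 / (2 * Complex.I * (ħ : ℂ)))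
      * (2 * (Complex.I * (ħ : ℂ)) ^ 2)) = 1 := by
    rw [mul_assoc 2]
    generalize Complex.I * (ħ : ℂ) = c at hc
    field_simp
  have r₁₂ : (1 / (Complex.I * (ħ : ℂ))) • comm c₁₂
      ((1 / (2 * Complex.I * (ħ : ℂ))) • comm c₁₂ c₂₃)
      = c₂₃ * c₁₂ - c₁₂ * c₁₃ + (c₂ - c₁) * (c₃ - c₁₂₃) := by
    rw [s, comm₁₂, smul_smul, smul_smul, mul_assoc, hcc, one_smul]
  have r₂₃ : (1 / (Complex.I * (ħ : ℂ))) • comm c₂₃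
      ((1 / (2 * Complex.I * (ħ : ℂ))) • comm c₁₂ c₂₃)
      = c₁₃ * c₂₃ - c₂₃ * c₁₂ + (c₃ - c₂) * (c₁ - c₁₂₃) := by
    rw [s, ← q₂₃, comm₂₃, smul_smul, smul_smul, mul_assoc, hcc, one_smul]
  have sum_zero : comm c₁₂ ((1 / (2 * Complex.I * (ħ : ℂ))) • comm c₁₂ c₂₃)
      + comm c₂₃ ((1 / (2 * Complex.I * (ħ : ℂ))) • comm c₁₂ c₂₃)
      + comm c₁₃ ((1 / (2 * Complex.I * (ħ : ℂ))) • comm c₁₂ c₂₃) = 0 := by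
    have w : ∀ z ∈ ({c₁, c₂, c₃, c₁₂₃} : Set B), Commute z (comm c₁₂ c₂₃) := fun z hz => by
      have h₁ : Commute z c₁₂ := comm_eq_zero_iff.1 (central z hz c₁₂ (by simp))
      have h₂ : Commute z c₂₃ := comm_eq_zero_iff.1 (central z hz c₂₃ (by simp))
      exact (h₁.mul_right h₂).sub_right (h₂.mul_right h₁)
    have w₁ := (w c₁ (by simp)).eq
    have w₂ := (w c₂ (by simp)).eq
    have w₃ := (w c₃ (by simp)).eq
    have w₀ := (w c₁₂₃ (by simp)).eq
    rw [s, s, s, ← smul_add, ← smul_add, h₁₃]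
    generalize comm c₁₂ c₂₃ = F at *
    simp only [comm, mul_add, add_mul, mul_sub, sub_mul, w₁, w₂, w₃, w₀]
    module
  refine ⟨linear, central, rfl, by rw [q₂₃], by rw [q₁₃], r₁₂, r₂₃, ?_, ?_, ?_, ?_, sum_zero,
    ?_, ?_⟩
  -- The third cubic relation is minus the sum of the other two; the products of central elements
  -- cancel cyclically.
  · have h := congrArg (fun x => (1 / (Complex.I * (ħ : ℂ))) • x) sum_zero
    simp only [smul_add, smul_zero, r₁₂, r₂₃] at h
    rw [eq_neg_of_add_eq_zero_right h]
    simp only [mul_sub, sub_mul, z₁ c₂ (by simp), z₁ c₃ (by simp), z₂ c₃ (by simp)]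
    abel
  · have h : comm c₂₃ (c₁₂ + c₁₃) = comm c₂₃ c₁₃ - comm c₁₂ c₂₃ := by
      simp only [comm, mul_add, add_mul]; abel
    rw [h, q₂₃, sub_self]
  · have h : comm c₁₂ (c₁₃ + c₂₃) = comm c₁₂ c₂₃ - comm c₁₃ c₁₂ := by
      simp only [comm, mul_add, add_mul]; abel
    rw [h, q₁₃, sub_self]
  · have h : comm c₁₃ (c₁₂ + c₂₃) = comm c₁₃ c₁₂ - comm c₂₃ c₁₃ := by
      simp only [comm, mul_add, add_mul]; abel
    rw [h, q₁₃, q₂₃, sub_self]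
  · rw [r₁₂, h₁₃]
    simp only [acomm, pow_two, mul_add, add_mul, mul_sub, z₁ c₁₂ (by simp), z₂ c₁₂ (by simp),
      z₃ c₁₂ (by simp), z₀ c₁₂ (by simp)]
    abel
  · rw [r₂₃, h₁₃]
    simp only [acomm, pow_two, add_mul, sub_mul]
    abel

/-- The rank one Racah relations for three commuting triples. -/
theorem racahRelations_casOf (hħ : ħ ≠ 0) {t u v : Gen → B} (ht : SlTriple ħ t)
    (hu : SlTriple ħ u) (hv : SlTriple ħ v) (htu : ∀ σ τ, Commute (t σ) (u τ))
    (htv : ∀ σ τ, Commute (t σ) (v τ)) (huv : ∀ σ τ, Commute (u σ) (v τ)) :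
    RacahRelations ħ (casOf t) (casOf u) (casOf v) (casOf (t + u)) (casOf (u + v))
      (casOf (t + v)) (casOf (t + u + v))
      ((1 / (2 * Complex.I * (ħ : ℂ))) • comm (casOf (t + u)) (casOf (u + v))) := by
  have htuv : ∀ σ τ, Commute ((t + u) σ) (v τ) := fun σ τ => (htv σ τ).add_left (huv σ τ)
  have a₁ : ∀ τ, Commute (casOf t) (t τ) := ht.casOf_commute
  have a₂ : ∀ τ, Commute (casOf t) (u τ) := fun τ => (commute_casOf fun σ => (htu σ τ).symm).symm
  have a₃ : ∀ τ, Commute (casOf t) (v τ) := fun τ => (commute_casOf fun σ => (htv σ τ).symm).symm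
  have b₁ : ∀ τ, Commute (casOf u) (t τ) := fun τ => (commute_casOf fun σ => htu τ σ).symm
  have b₂ : ∀ τ, Commute (casOf u) (u τ) := hu.casOf_commute
  have b₃ : ∀ τ, Commute (casOf u) (v τ) := fun τ => (commute_casOf fun σ => (huv σ τ).symm).symm
  have d₁ : ∀ τ, Commute (casOf v) (t τ) := fun τ => (commute_casOf fun σ => htv τ σ).symm
  have d₂ : ∀ τ, Commute (casOf v) (u τ) := fun τ => (commute_casOf fun σ => huv τ σ).symm
  have d₃ : ∀ τ, Commute (casOf v) (v τ) := hv.casOf_commute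
  have tot : ∀ σ, Commute (casOf (t + u + v)) ((t + u + v) σ) :=
    ((ht.add hu htu).add hv htuv).casOf_commute
  refine racahRelations_of_comm hħ ?_ ?_ ?_ ?_
  · rw [casOf_add htuv, casOf_add htu, casOf_add htv, casOf_add huv]
    simp only [dotOf, Pi.add_apply, add_mul]
    module
  · have of_all : ∀ z : B, (∀ σ, Commute z (t σ)) → (∀ σ, Commute z (u σ)) →
        (∀ σ, Commute z (v σ)) → ∀ g ∈ ({casOf t, casOf u, casOf v, casOf (t + u), casOf (u + v),
          casOf (t + v), casOf (t + u + v)} : Set B), comm z g = 0 := by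
      intro z z₁ z₂ z₃ g hg
      rw [comm_eq_zero_iff]
      simp only [Set.mem_insert_iff, Set.mem_singleton_iff] at hg
      rcases hg with rfl | rfl | rfl | rfl | rfl | rfl | rfl
      · exact commute_casOf z₁
      · exact commute_casOf z₂
      · exact commute_casOf z₃
      · exact commute_casOf fun σ => (z₁ σ).add_right (z₂ σ)
      · exact commute_casOf fun σ => (z₂ σ).add_right (z₃ σ)
      · exact commute_casOf fun σ => (z₁ σ).add_right (z₃ σ)
      · exact commute_casOf fun σ => ((z₁ σ).add_right (z₂ σ)).add_right (z₃ σ)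
    intro z hz
    simp only [Set.mem_insert_iff, Set.mem_singleton_iff] at hz
    rcases hz with rfl | rfl | rfl | rfl
    · exact of_all _ a₁ a₂ a₃
    · exact of_all _ b₁ b₂ b₃
    · exact of_all _ d₁ d₂ d₃
    · intro g hg
      rw [comm_eq_zero_iff]
      refine (commute_casOf fun σ => ?_).symm
      simp only [Set.mem_insert_iff, Set.mem_singleton_iff] at hg
      rcases hg with rfl | rfl | rfl | rfl | rfl | rfl | rfl
      · exact ((a₁ σ).add_right (a₂ σ)).add_right (a₃ σ)
      · exact ((b₁ σ).add_right (b₂ σ)).add_right (b₃ σ)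
      · exact ((d₁ σ).add_right (d₂ σ)).add_right (d₃ σ)
      · refine Commute.add_right ((ht.add hu htu).casOf_commute σ) ?_
        exact (commute_casOf fun τ => (htuv τ σ).symm).symm
      · rw [add_assoc]
        refine Commute.add_right ?_ ((hu.add hv huv).casOf_commute σ)
        exact (commute_casOf fun τ => (htu σ τ).add_right (htv σ τ)).symm
      · rw [add_right_comm]
        refine Commute.add_right ((ht.add hv htv).casOf_commute σ) ?_
        exact (commute_casOf fun τ => (htu τ σ).symm.add_right (huv σ τ)).symm
      · exact tot σ
  · exact comm_comm_casOf ht hu htu htv huv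
  · have h := comm_comm_casOf hu hv huv (fun σ τ => (htu τ σ).symm) fun σ τ => (htv τ σ).symm
    -- The second double commutator is the first one for the cyclic permutation `(u, v, t)`.
    rwa [add_comm v t, add_comm u t, show u + v + t = t + u + v by abel] at h

end Relations

/-! ### Commutation rules for multiplications and derivatives -/

section Weyl

variable {n : ℕ}

theorem smooth_ext {f g : Smooth n} (h : ∀ x ∈ regularSet n, f.1 x = g.1 x) : f = g := by
  refine Subtype.ext (funext fun x => ?_)
  by_cases hx : x ∈ regularSet n
  · exact h x hx
  · rw [f.2.2 x hx, g.2.2 x hx]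

theorem D_apply (i : Fin n) (f : Smooth n) {x : Fin n → ℝ} (hx : x ∈ regularSet n) :
    (D n i f).1 x = fderiv ℝ f.1 x (Pi.single i 1) := by
  classical
  exact Set.indicator_of_mem hx fun x => fderiv ℝ f.1 x (Pi.single i 1)

theorem X_apply (i : Fin n) (f : Smooth n) (x : Fin n → ℝ) :
    (X n i f).1 x = (x i : ℂ) * f.1 x := rfl

theorem Xinv_apply (i : Fin n) (f : Smooth n) (x : Fin n → ℝ) :
    (Xinv n i f).1 x = (x i : ℂ)⁻¹ * f.1 x := rfl

theorem mulOp_commute (g h : (Fin n → ℝ) → ℂ) (hg hh) : Commute (mulOp n g hg) (mulOp n h hh) :=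
  LinearMap.ext fun f => Subtype.ext <| funext fun x => mul_left_comm (g x) (h x) (f.1 x)

theorem X_commute (i j : Fin n) : Commute (X n i) (X n j) := mulOp_commute _ _ _ _

theorem X_commute_Xinv (i j : Fin n) : Commute (X n i) (Xinv n j) := mulOp_commute _ _ _ _

theorem Xinv_commute (i j : Fin n) : Commute (Xinv n i) (Xinv n j) := mulOp_commute _ _ _ _

theorem X_mul_Xinv (i : Fin n) : X n i * Xinv n i = 1 := by
  refine LinearMap.ext fun f => smooth_ext fun x hx => ?_
  have : (x i : ℂ) ≠ 0 := by exact_mod_cast hx i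
  change (x i : ℂ) * ((x i : ℂ)⁻¹ * f.1 x) = f.1 x
  rw [mul_inv_cancel_left₀ this]

theorem Xinv_mul_X (i : Fin n) : Xinv n i * X n i = 1 := by
  rw [← (X_commute_Xinv i i).eq, X_mul_Xinv]

theorem D_mul_X (i j : Fin n) :
    D n i * X n j = X n j * D n i + if i = j then 1 else 0 := by
  refine LinearMap.ext fun f => smooth_ext fun x hx => ?_
  have hc : HasFDerivAt (fun x : Fin n → ℝ => ((x j : ℝ) : ℂ))
      (Complex.ofRealCLM.comp (ContinuousLinearMap.proj j)) x :=
    (Complex.ofRealCLM.comp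
      (ContinuousLinearMap.proj (R := ℝ) (φ := fun _ : Fin n => ℝ) j)).hasFDerivAt
  have h := (hc.mul (smooth_differentiableAt f hx).hasFDerivAt).fderiv
  have e : (D n i (X n j f)).1 x = (x j : ℂ) * fderiv ℝ f.1 x (Pi.single i 1)
      + f.1 x * ((Pi.single i 1 : Fin n → ℝ) j : ℂ) := by
    rw [D_apply i _ hx]
    refine (congrArg (fun L => L (Pi.single i 1)) h).trans ?_
    simp
  have e' : ((X n j * D n i + if i = j then 1 else 0) f).1 x
      = (x j : ℂ) * (D n i f).1 x + if i = j then f.1 x else 0 := by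
    split_ifs
    · rfl
    · rw [add_zero, add_zero]; rfl
  refine e.trans (Eq.trans ?_ e'.symm)
  rw [D_apply i f hx, Pi.single_apply]
  by_cases hij : i = j
  · simp [hij]
  · simp [hij, Ne.symm hij]

theorem D_mul_X_self (i : Fin n) : D n i * X n i = X n i * D n i + 1 := by
  rw [D_mul_X, if_pos rfl]

theorem D_commute_X {i j : Fin n} (h : i ≠ j) : Commute (D n i) (X n j) := by
  rw [commute_iff_eq, D_mul_X, if_neg h, add_zero]

/-- Multiplying the relation between `D` and `X` by `Xinv` on both sides avoids differentiating the
reciprocal. -/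
theorem D_mul_Xinv_self (i : Fin n) :
    D n i * Xinv n i = Xinv n i * D n i - Xinv n i * Xinv n i := by
  have h : Xinv n i * (D n i * X n i) * Xinv n i = Xinv n i * (X n i * D n i + 1) * Xinv n i := by
    rw [D_mul_X_self]
  rw [mul_assoc, mul_assoc (D n i), X_mul_Xinv, mul_add, ← mul_assoc, ← mul_assoc,
    Xinv_mul_X, mul_one, one_mul, mul_one, add_mul] at h
  rw [h]
  abel

theorem D_commute_Xinv {i j : Fin n} (h : i ≠ j) : Commute (D n i) (Xinv n j) := by
  have e : Xinv n j * (D n i * X n j) * Xinv n j = Xinv n j * (X n j * D n i) * Xinv n j := by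
    rw [(D_commute_X h).eq]
  rw [mul_assoc, mul_assoc (D n i), X_mul_Xinv, ← mul_assoc (Xinv n j) (X n j), Xinv_mul_X,
    mul_one, one_mul] at e
  exact e.symm

theorem D_D_apply (i j : Fin n) (f : Smooth n) {x : Fin n → ℝ} (hx : x ∈ regularSet n) :
    (D n i (D n j f)).1 x = fderiv ℝ (fderiv ℝ f.1) x (Pi.single i 1) (Pi.single j 1) := by
  rw [D_apply i _ hx]
  have hn := (isOpen_regularSet n).mem_nhds hx
  have e : (D n j f).1 =ᶠ[nhds x] fun y => fderiv ℝ f.1 y (Pi.single j 1) := by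
    filter_upwards [hn] with y hy
    exact D_apply j f hy
  rw [e.fderiv_eq]
  have hd : DifferentiableAt ℝ (fderiv ℝ f.1) x := by
    have := (f.2.1.contDiffAt hn).fderiv_right (m := 1) (by norm_cast)
    exact this.differentiableAt (by simp)
  rw [fderiv_clm_apply hd (differentiableAt_const _)]
  simp

/-- Symmetry of the second derivative of a smooth function. -/
theorem D_commute (i j : Fin n) : Commute (D n i) (D n j) := by
  refine LinearMap.ext fun f => smooth_ext fun x hx => ?_
  have hs : IsSymmSndFDerivAt ℝ f.1 x :=
    ContDiffAt.isSymmSndFDerivAt (f.2.1.contDiffAt ((isOpen_regularSet n).mem_nhds hx))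
      (by simpa using by norm_cast)
  change (D n i (D n j f)).1 x = (D n j (D n i f)).1 x
  rw [D_D_apply i j f hx, D_D_apply j i f hx, hs.eq]

end Weyl

/-! ### The one-site realisation -/

section Realisation

variable {n : ℕ} (ħ : ℝ)

/-- Allows all scalars to be polynomials in the single quantity `c = iħ`, which can then be
generalised so that `module` never needs the value of `I ^ 2`. -/
theorem sq_eq_neg_I_mul_sq : (ħ : ℂ) ^ 2 = -(Complex.I * (ħ : ℂ)) ^ 2 := by
  rw [mul_pow, Complex.I_sq]; ring

/-- An invertible element `x` with inverse `y`, and an element `d` with `[d, x] = 1`. -/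
structure WeylTriple {B : Type*} [Ring B] (x y d : B) : Prop where
  x_y : x * y = 1
  y_x : y * x = 1
  d_x : d * x = x * d + 1
  d_y : d * y = y * d - y * y

theorem weylTriple (i : Fin n) : WeylTriple (X n i) (Xinv n i) (D n i) :=
  ⟨X_mul_Xinv i, Xinv_mul_X i, D_mul_X_self i, D_mul_Xinv_self i⟩

/-! ### One-site and two-site Casimirs in an abstract Weyl algebra with invertible coordinate -/

section Abstract

variable {B : Type*} [Ring B] [Algebra ℂ B]

/-- The differential realisation of `J₊, J₋, J₃` in terms of `x`, its inverse `y`, and `d`. -/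
def weylJ (α : ℂ) (x y d : B) : Gen → B
  | .plus => (1 / 2 : ℂ) • (-((ħ : ℂ) ^ 2 • d ^ 2) + α • y ^ 2)
  | .minus => (1 / 2 : ℂ) • x ^ 2
  | .three => (-(Complex.I * (ħ : ℂ) / 2)) • (x * d + (1 / 2 : ℂ) • 1)

theorem WeylTriple.slTriple {x y d : B} (h : WeylTriple x y d) (α : ℂ) :
    SlTriple ħ (weylJ ħ α x y d) := by
  obtain ⟨h₁, h₂, h₃, h₄⟩ := h
  refine ⟨?_, ?_, ?_⟩ <;>
  · simp only [weylJ, sq_eq_neg_I_mul_sq, mul_assoc (2 : ℂ)]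
    generalize Complex.I * (ħ : ℂ) = c
    simp only [pow_two, mul_add, add_mul, sub_mul, mul_sub, smul_mul_assoc,
      mul_smul_comm, mul_assoc, h₁, h₂, h₃, h₄, mul_left_of_eq h₁, mul_left_of_eq h₂,
      mul_left_of_eq h₃, mul_left_of_eq h₄, smul_sub, smul_add, one_mul, mul_one, neg_mul, mul_neg]
    module

theorem weylJ_commute (α β : ℂ) {x y d x' y' d' : B}
    (h : ∀ z ∈ ({x, y, d} : Set B), ∀ w ∈ ({x', y', d'} : Set B), Commute z w) (σ τ : Gen) :
    Commute (weylJ ħ α x y d σ) (weylJ ħ β x' y' d' τ) := by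
  have main : ∀ (γ : ℂ) (u v w z : B), Commute z u → Commute z v → Commute z w → ∀ ν,
      Commute z (weylJ ħ γ u v w ν) := by
    intro γ u v w z h₁ h₂ h₃ ν
    cases ν
    · exact Commute.smul_right (((h₃.pow_right 2).smul_right _).neg_right.add_right
        ((h₂.pow_right 2).smul_right _)) _
    · exact (h₁.pow_right 2).smul_right _
    · exact Commute.smul_right ((h₁.mul_right h₃).add_right ((Commute.one_right _).smul_right _)) _
  have main' : ∀ z ∈ ({x, y, d} : Set B), Commute (weylJ ħ β x' y' d' τ) z := fun z hz =>
    (main _ _ _ _ _ (h z hz x' (by simp)) (h z hz y' (by simp)) (h z hz d' (by simp)) τ).symm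
  exact (main _ _ _ _ _ (main' x (by simp)) (main' y (by simp)) (main' d (by simp)) σ).symm

theorem WeylTriple.casOf_weylJ {x y d : B} (h : WeylTriple x y d) (α : ℂ) :
    casOf (weylJ ħ α x y d) = ((1 / 16 : ℂ) * (3 * (ħ : ℂ) ^ 2 - 4 * α)) • 1 := by
  obtain ⟨h₁, h₂, h₃, h₄⟩ := h
  simp only [casOf, weylJ, sq_eq_neg_I_mul_sq]
  generalize Complex.I * (ħ : ℂ) = c
  simp only [pow_two, mul_add, add_mul, mul_sub, smul_mul_assoc,
    mul_smul_comm, mul_assoc, h₁, h₂, h₃, mul_left_of_eq h₁, mul_left_of_eq h₂,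
    mul_left_of_eq h₃, smul_add, one_mul, mul_one, neg_mul, mul_neg]
  module

theorem WeylTriple.casOf_weylJ_add {x y d x' y' d' : B} (h : WeylTriple x y d)
    (h' : WeylTriple x' y' d') (α β : ℂ)
    (hc : ∀ z ∈ ({x, y, d} : Set B), ∀ w ∈ ({x', y', d'} : Set B), Commute z w) :
    casOf (weylJ ħ α x y d + weylJ ħ β x' y' d') = (-(1 / 4) : ℂ) •
      ((x * (-(Complex.I * (ħ : ℂ)) • d') - x' * (-(Complex.I * (ħ : ℂ)) • d)) ^ 2
        + α • (x' ^ 2 * y ^ 2) + β • (x ^ 2 * y' ^ 2) + (α + β - (ħ : ℂ) ^ 2) • 1) := by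
  rw [casOf_add (weylJ_commute ħ α β hc), h.casOf_weylJ, h'.casOf_weylJ]
  obtain ⟨h₁, h₂, h₃, h₄⟩ := h
  obtain ⟨k₁, k₂, k₃, k₄⟩ := h'
  have e : ∀ z ∈ ({x, y, d} : Set B), ∀ w ∈ ({x', y', d'} : Set B), w * z = z * w :=
    fun z hz w hw => (hc z hz w hw).eq.symm
  have m₁ := e x (by simp) x' (by simp)
  have m₂ := e x (by simp) y' (by simp)
  have m₃ := e x (by simp) d' (by simp)
  have m₄ := e y (by simp) x' (by simp)
  have m₅ := e y (by simp) y' (by simp)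
  have m₆ := e y (by simp) d' (by simp)
  have m₇ := e d (by simp) x' (by simp)
  have m₈ := e d (by simp) y' (by simp)
  have m₉ := e d (by simp) d' (by simp)
  -- Used to move the letters of the first site to the left of those of the second, also inside
  -- longer words.
  have l : ∀ {z w : B}, w * z = z * w → ∀ s, w * (z * s) = z * (w * s) := fun h s => by
    rw [← mul_assoc, h, mul_assoc]
  simp only [dotOf, weylJ, sq_eq_neg_I_mul_sq]
  generalize Complex.I * (ħ : ℂ) = c
  simp only [pow_two, mul_add, add_mul, mul_sub, sub_mul, smul_mul_assoc,
    mul_smul_comm, mul_assoc,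
    mul_left_of_eq h₃, k₃,
    smul_sub, smul_add, one_mul, mul_one, neg_mul, mul_neg,
    m₄, m₇, l m₁, l m₃, l m₄, l m₇, l m₉]
  module

end Abstract

theorem JOp_eq (a : Fin n → ℝ) (i : Fin n) :
    JOp ħ a i = weylJ ħ (a i) (X n i) (Xinv n i) (D n i) := by
  funext σ
  cases σ <;> rfl

theorem letters_commute {i j : Fin n} (h : i ≠ j) :
    ∀ z ∈ ({X n i, Xinv n i, D n i} : Set (Op n)), ∀ w ∈ ({X n j, Xinv n j, D n j} : Set (Op n)),
      Commute z w := by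
  intro z hz w hw
  simp only [Set.mem_insert_iff, Set.mem_singleton_iff] at hz hw
  rcases hz with rfl | rfl | rfl <;> rcases hw with rfl | rfl | rfl
  · exact X_commute i j
  · exact X_commute_Xinv i j
  · exact (D_commute_X h.symm).symm
  · exact (X_commute_Xinv j i).symm
  · exact Xinv_commute i j
  · exact (D_commute_Xinv h.symm).symm
  · exact D_commute_X h
  · exact D_commute_Xinv h
  · exact D_commute i j

theorem slTriple_JOp (a : Fin n → ℝ) (i : Fin n) : SlTriple ħ (JOp ħ a i) := by
  rw [JOp_eq]
  exact (weylTriple i).slTriple ħ _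

theorem JOp_commute (a : Fin n → ℝ) {i j : Fin n} (h : i ≠ j) (σ τ : Gen) :
    Commute (JOp ħ a i σ) (JOp ħ a j τ) := by
  rw [JOp_eq, JOp_eq]
  exact weylJ_commute ħ _ _ (letters_commute h) σ τ

theorem casOf_JOp (a : Fin n → ℝ) (i : Fin n) : casOf (JOp ħ a i) = C1 ħ i a := by
  rw [JOp_eq]
  exact (weylTriple i).casOf_weylJ ħ _

theorem casOf_JOp_add (a : Fin n → ℝ) {i j : Fin n} (hij : i ≠ j) :
    casOf (JOp ħ a i + JOp ħ a j) = C2 ħ i j a := by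
  rw [JOp_eq, JOp_eq]
  exact (weylTriple i).casOf_weylJ_add ħ (weylTriple j) _ _ (letters_commute hij)

/-- The one-site realisation, as a family of operators depending on the parameters. -/
def tripleAt (i : Fin n) (σ : Gen) : OpFamily n := fun a => JOp ħ a i σ

theorem slTriple_tripleAt (i : Fin n) : SlTriple ħ (tripleAt ħ i) :=
  ⟨funext fun a => (slTriple_JOp ħ a i).minus_plus, funext fun a => (slTriple_JOp ħ a i).three_plus,
    funext fun a => (slTriple_JOp ħ a i).three_minus⟩

theorem tripleAt_commute {i j : Fin n} (h : i ≠ j) (σ τ : Gen) :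
    Commute (tripleAt ħ i σ) (tripleAt ħ j τ) :=
  funext fun a => (JOp_commute ħ a h σ τ).eq

theorem casOf_tripleAt (i : Fin n) : casOf (tripleAt ħ i) = C1 ħ i :=
  funext fun a => casOf_JOp ħ a i

theorem casOf_tripleAt_add {i j : Fin n} (h : i ≠ j) :
    casOf (tripleAt ħ i + tripleAt ħ j) = C2 ħ i j :=
  funext fun a => casOf_JOp_add ħ a h

/-- The realisation of `𝔄` at a site. -/
def siteRep (i : Fin n) : Alg ħ →ₐ[ℂ] OpFamily n := (slTriple_tripleAt ħ i).lift

theorem siteRep_J (i : Fin n) (σ : Gen) : siteRep ħ i (J ħ σ) = tripleAt ħ i σ :=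
  SlTriple.lift_J _ _

theorem siteRep_commute (i j : Fin n) (h : i ≠ j) (x y : Alg ħ) :
    Commute (siteRep ħ i x) (siteRep ħ j y) :=
  commute_of_generators₂ (B := OpFamily n) (siteRep ħ i) (siteRep ħ j) (fun σ τ => by
    rw [siteRep_J, siteRep_J]; exact tripleAt_commute ħ h σ τ) x y

/-- The differential realisation of the chain. -/
def realisation (n : ℕ) : Chain ħ n →ₐ[ℂ] OpFamily n :=
  chainLift (B := OpFamily n) (siteRep ħ) (siteRep_commute ħ)

theorem realisation_site (i : Fin n) (x : Alg ħ) :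
    realisation ħ n (site ħ n i x) = siteRep ħ i x := by
  have h := chainLift_site (B := OpFamily n) (siteRep ħ) (siteRep_commute ħ) i x
  rw [realisation]
  exact h

theorem isRealisation_realisation (n : ℕ) : IsRealisation ħ n (realisation ħ n) := fun i σ a => by
  rw [realisation_site, siteRep_J]
  rfl

/-! ### The intermediate Casimirs as operators -/

/-- In the sum over pairs, each one-term Casimir occurs `A.card - 1` times, while the quadratic form
of the total contains it once; this is the origin of the coefficient `A.card - 2`. -/
theorem casOf_sum {B ι : Type*} [Ring B] [Algebra ℂ B] [LinearOrder ι] (t : ι → Gen → B)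
    (ht : ∀ i j, i ≠ j → ∀ σ τ, Commute (t i σ) (t j τ)) (A : Finset ι) :
    casOf (∑ i ∈ A, t i) = ∑ j ∈ A, ∑ i ∈ A with i < j, casOf (t i + t j)
      - ((A.card : ℂ) - 2) • ∑ i ∈ A, casOf (t i) := by
  -- Adding a new maximum `a` means that the new ordered pairs are exactly `(i, a)` with `i ∈ A`.
  induction A using Finset.induction_on_max with
  | empty => simp [casOf]
  | insert a A hmax ih =>
    have ha : a ∉ A := fun h => lt_irrefl _ (hmax a h)
    have hne : ∀ i ∈ A, i ≠ a := fun i hi e => ha (e ▸ hi)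
    have hc : ∀ σ τ, Commute ((∑ i ∈ A, t i) σ) (t a τ) := fun σ τ => by
      rw [Finset.sum_apply]
      exact Commute.sum_left _ _ _ fun i hi => ht i a (hne i hi) σ τ
    have f₁ : (insert a A).filter (· < a) = A := by
      ext i
      simp only [Finset.mem_filter, Finset.mem_insert]
      exact ⟨fun h => h.1.resolve_left h.2.ne, fun h => ⟨Or.inr h, hmax i h⟩⟩
    have f₂ : ∀ j ∈ A, (insert a A).filter (· < j) = A.filter (· < j) := fun j hj => by
      rw [Finset.filter_insert, if_neg (hmax j hj).asymm]
    have hdot : (2 : ℂ) • dotOf (∑ i ∈ A, t i) (t a)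
        = ∑ i ∈ A, casOf (t i + t a) - ∑ i ∈ A, casOf (t i) - (A.card : ℂ) • casOf (t a) := by
      have : dotOf (∑ i ∈ A, t i) (t a) = ∑ i ∈ A, dotOf (t i) (t a) := by
        simp only [dotOf, Finset.sum_apply, Finset.sum_mul, Finset.sum_sub_distrib,
          Finset.smul_sum, smul_add, Finset.sum_add_distrib]
      rw [this, Finset.sum_congr rfl fun i hi => casOf_add (ht i a (hne i hi))]
      simp only [Finset.sum_add_distrib, Finset.sum_const, ← Finset.smul_sum,
        ← Nat.cast_smul_eq_nsmul ℂ]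
      module
    rw [Finset.sum_insert ha, Finset.sum_insert ha, Finset.sum_insert ha, f₁,
      add_comm (t a), casOf_add hc, ih, hdot, Finset.card_insert_of_notMem ha]
    have f₃ : ∑ j ∈ A, ∑ i ∈ insert a A with i < j, casOf (t i + t j)
        = ∑ j ∈ A, ∑ i ∈ A with i < j, casOf (t i + t j) :=
      Finset.sum_congr rfl fun j hj => by rw [f₂ j hj]
    rw [f₃]
    push_cast
    module

theorem sum_pairs_lt {ι M : Type*} [Fintype ι] [LinearOrder ι] [AddCommMonoid M]
    (A : Finset ι) (q : ι × ι → Prop) [DecidablePred q]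
    (hq : ∀ p, q p ↔ p.1 < p.2 ∧ p.1 ∈ A ∧ p.2 ∈ A) (f : ι → ι → M) :
    ∑ p : ι × ι with q p, f p.1 p.2 = ∑ j ∈ A, ∑ i ∈ A with i < j, f i j := by
  rw [Finset.sum_sigma']
  refine Finset.sum_bij' (fun p _ => ⟨p.2, p.1⟩) (fun p _ => (p.2, p.1)) ?_ ?_ ?_ ?_ ?_
  · intro p hp
    have := (hq p).1 (Finset.mem_filter.1 hp).2
    simp [this]
  · intro p hp
    simp only [Finset.mem_sigma, Finset.mem_filter] at hp
    simp [hq, hp]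
  · simp
  · simp
  · simp

theorem realisation_coproduct_J (A : Finset (Fin n)) (σ : Gen) :
    realisation ħ n (coproduct ħ n A (J ħ σ)) = (∑ i ∈ A, tripleAt ħ i) σ := by
  rw [coproduct_J, map_sum, Finset.sum_apply]
  exact Finset.sum_congr rfl fun i _ => by rw [realisation_site, siteRep_J]

theorem realisation_casimirOn (A : Finset (Fin n)) :
    realisation ħ n (casimirOn ħ n A) = casOf (∑ i ∈ A, tripleAt ħ i) := by
  have h := map_casimir (B := OpFamily n) ((realisation ħ n).comp (coproduct ħ n A))
  refine h.trans (congrArg casOf (funext fun σ => ?_))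
  exact realisation_coproduct_J ħ A σ

theorem casOf_sum_tripleAt (A : Finset (Fin n)) (q : Fin n × Fin n → Prop) [DecidablePred q]
    (hq : ∀ p, q p ↔ p.1 < p.2 ∧ p.1 ∈ A ∧ p.2 ∈ A) :
    casOf (∑ i ∈ A, tripleAt ħ i) = ∑ p : Fin n × Fin n with q p, C2 ħ p.1 p.2
      - ((A.card : ℂ) - 2) • ∑ i ∈ A, C1 ħ i := by
  rw [casOf_sum (B := OpFamily n) (tripleAt ħ) fun i j h => tripleAt_commute ħ h, sum_pairs_lt A q hq]
  simp only [casOf_tripleAt]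
  congr 1
  refine Finset.sum_congr rfl fun j _ => Finset.sum_congr rfl fun i hi => ?_
  exact casOf_tripleAt_add ħ (Finset.mem_filter.1 hi).2.ne

theorem card_filter_le {m : ℕ} (hm : m ≤ n) :
    (Finset.univ.filter fun i : Fin n => (i : ℕ) + 1 ≤ m).card = m := by
  have h := Fin.card_filter_val_lt (n := n) (m := m)
  rw [min_eq_right hm] at h
  exact h

/-- Stated in `ℂ` so that `n - m + 1` is a true difference, correct up to the empty range `m = n +
1`. -/
theorem card_filter_ge {m : ℕ} (hm : 1 ≤ m) (hm' : m ≤ n + 1) :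
    ((Finset.univ.filter fun i : Fin n => m ≤ (i : ℕ) + 1).card : ℂ) = n - m + 1 := by
  have h := Finset.card_filter_add_card_filter_not (s := (Finset.univ : Finset (Fin n)))
    (fun i : Fin n => (i : ℕ) + 1 ≤ m - 1)
  rw [card_filter_le (by omega), Finset.card_univ, Fintype.card_fin] at h
  have e : (Finset.univ.filter fun i : Fin n => ¬ (i : ℕ) + 1 ≤ m - 1)
      = Finset.univ.filter fun i : Fin n => m ≤ (i : ℕ) + 1 :=
    Finset.filter_congr fun i _ => by omega
  rw [e] at h
  have h' : (Finset.univ.filter fun i : Fin n => m ≤ (i : ℕ) + 1).card + m = n + 1 := by omega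
  have := congrArg (Nat.cast : ℕ → ℂ) h'
  push_cast at this
  linear_combination this

theorem leftCas_eq {m : ℕ} (hm : m ≤ n) :
    leftCas ħ n m = casOf (∑ i ∈ (Finset.univ : Finset (Fin n)) with i.val + 1 ≤ m, tripleAt ħ i) := by
  rw [casOf_sum_tripleAt ħ _ (fun p => p.1 < p.2 ∧ (p.2 : ℕ) + 1 ≤ m), card_filter_le hm, leftCas]
  intro p
  simp only [Finset.mem_filter, Finset.mem_univ, true_and, Fin.lt_def]
  omega

theorem rightCas_eq {m : ℕ} (hm : 1 ≤ m) (hm' : m ≤ n + 1) :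
    rightCas ħ n m = casOf (∑ i ∈ (Finset.univ : Finset (Fin n)) with m ≤ i.val + 1, tripleAt ħ i) := by
  rw [casOf_sum_tripleAt ħ _ (fun p => p.1 < p.2 ∧ m ≤ (p.1 : ℕ) + 1), card_filter_ge hm hm',
    rightCas]
  intro p
  simp only [Finset.mem_filter, Finset.mem_univ, true_and, Fin.lt_def]
  omega

theorem siteCas_eq {k : ℕ} (hk : 1 ≤ k) (hk' : k ≤ n) :
    siteCas ħ n k = casOf (∑ i ∈ (Finset.univ : Finset (Fin n)) with i.val + 1 = k, tripleAt ħ i) := by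
  have h : (Finset.univ.filter fun i : Fin n => (i : ℕ) + 1 = k) = {⟨k - 1, by omega⟩} := by
    ext i
    simp only [Finset.mem_filter, Finset.mem_univ, true_and, Finset.mem_singleton, Fin.ext_iff]
    omega
  rw [siteCas, h, Finset.sum_singleton, Finset.sum_singleton, casOf_tripleAt]

end Realisation

/-! ### Ordered monomials span `𝔄` -/

section Span

variable (ħ : ℝ)

/-- The ordered monomials `J₋^p J₃^q J₊^r`, indexed by `(r, p, q)`. -/
def ordMonomial (b : ℕ × ℕ × ℕ) : Alg ħ :=
  J ħ .minus ^ b.2.1 * (J ħ .three ^ b.2.2 * J ħ .plus ^ b.1)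

/-- The spanning half of Poincaré–Birkhoff–Witt. The span is stable under left multiplication by
each generator, hence is a left ideal, and it contains `1`. The order of the three stability proofs
matters: moving `J₃` past `J₋` uses stability under `J₋`, and moving `J₊` uses both. -/
theorem span_ordMonomial : Submodule.span ℂ (Set.range (ordMonomial ħ)) = ⊤ := by
  set S := Submodule.span ℂ (Set.range (ordMonomial ħ)) with hS
  have mem : ∀ p q r, J ħ .minus ^ p * (J ħ .three ^ q * J ħ .plus ^ r) ∈ S := fun p q r =>
    Submodule.subset_span ⟨(r, p, q), rfl⟩
  have closed : ∀ σ, (∀ p q r, J ħ σ * (J ħ .minus ^ p * (J ħ .three ^ q * J ħ .plus ^ r)) ∈ S) →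
      ∀ s ∈ S, J ħ σ * s ∈ S := by
    intro σ h s hs
    induction hs using Submodule.span_induction with
    | mem s hs => obtain ⟨⟨r, p, q⟩, rfl⟩ := hs; exact h p q r
    | zero => rw [mul_zero]; exact S.zero_mem
    | add s s' _ _ hs hs' => rw [mul_add]; exact S.add_mem hs hs'
    | smul c s _ hs => rw [mul_smul_comm]; exact S.smul_mem c hs
  have hm : ∀ s ∈ S, J ħ .minus * s ∈ S := closed _ fun p q r => by
    rw [← mul_assoc, ← pow_succ']
    exact mem _ _ _
  have h3 : ∀ s ∈ S, J ħ .three * s ∈ S := closed _ fun p q r => by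
    induction p with
    | zero =>
      rw [pow_zero, one_mul, ← mul_assoc, ← pow_succ']
      simpa using mem 0 (q + 1) r
    | succ p ih =>
      rw [pow_succ', mul_assoc, ← mul_assoc, (slTriple_J ħ).three_minus', sub_mul, mul_assoc,
        smul_mul_assoc]
      exact S.sub_mem (hm _ ih) (S.smul_mem _ (hm _ (mem p q r)))
  have hp : ∀ s ∈ S, J ħ .plus * s ∈ S := closed _ fun p q r => by
    induction p with
    | zero =>
      rw [pow_zero, one_mul]
      induction q with
      | zero =>
        rw [pow_zero, one_mul, ← pow_succ']
        simpa using mem 0 0 (r + 1)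
      | succ q ih =>
        rw [pow_succ', mul_assoc, ← mul_assoc, (slTriple_J ħ).plus_three, sub_mul, mul_assoc,
          smul_mul_assoc]
        exact S.sub_mem (h3 _ ih) (S.smul_mem _ ih)
    | succ p ih =>
      rw [pow_succ', mul_assoc, ← mul_assoc, (slTriple_J ħ).plus_minus, sub_mul, mul_assoc,
        smul_mul_assoc]
      exact S.sub_mem (hm _ ih) (S.smul_mem _ (h3 _ (mem p q r)))
  have main : ∀ x : Alg ħ, ∀ s ∈ S, x * s ∈ S := by
    intro x
    have hx : x ∈ Algebra.adjoin ℂ (Set.range (J ħ)) := by rw [alg_adjoin_J]; trivial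
    induction hx using Algebra.adjoin_induction with
    | mem x hx =>
      obtain ⟨σ, rfl⟩ := hx
      cases σ
      · exact hp
      · exact hm
      · exact h3
    | algebraMap c =>
      intro s hs
      rw [← Algebra.smul_def]
      exact S.smul_mem c hs
    | add x y _ _ hx hy =>
      intro s hs
      rw [add_mul]
      exact S.add_mem (hx s hs) (hy s hs)
    | mul x y _ _ hx hy =>
      intro s hs
      rw [mul_assoc]
      exact hx _ (hy s hs)
  refine Submodule.eq_top_iff'.2 fun x => ?_
  simpa using main x 1 (by simpa using mem 0 0 0)

theorem span_pureTensor_ordMonomial (n : ℕ) :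
    Submodule.span ℂ (Set.range fun b : Fin n → ℕ × ℕ × ℕ =>
      pureTensor ħ fun i => ordMonomial ħ (b i)) = ⊤ :=
  PiTensorProduct.submodule_span_eq_top (R := ℂ) (M := fun _ : Fin n => Alg ħ)
    (γ := fun _ => ℕ × ℕ × ℕ) (g := fun _ => ordMonomial ħ) fun _ => span_ordMonomial ħ

end Span

/-! ### Linear independence of products of functions -/

section Independence

/-- Variables are separated one at a time. For fixed `s`, independence of the `u i s` in the second
variable isolates each `i`; varying `s` then isolates `j`. The family `w` may depend on `i`, and `u`
on `s`, which a plain tensor product of families would not allow. -/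
theorem linearIndependent_nested {ι κ S T : Type*} (w : ι → κ → S → ℂ) (u : ι → S → T → ℂ)
    (hw : ∀ i, LinearIndependent ℂ (w i)) (hu : ∀ s, LinearIndependent ℂ fun i => u i s) :
    LinearIndependent ℂ fun (b : ι × κ) (x : S × T) => w b.1 b.2 x.1 * u b.1 x.1 x.2 := by
  classical
  rw [linearIndependent_iff'']
  intro F g hg h
  have hF : F ⊆ F.image Prod.fst ×ˢ F.image Prod.snd := fun b hb =>
    Finset.mem_product.2 ⟨Finset.mem_image_of_mem _ hb, Finset.mem_image_of_mem _ hb⟩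
  rw [Finset.sum_subset hF fun b _ hb => by rw [hg b hb, zero_smul], Finset.sum_product] at h
  have h₁ : ∀ s, ∀ i ∈ F.image Prod.fst, ∑ j ∈ F.image Prod.snd, g (i, j) * w i j s = 0 := by
    intro s
    refine linearIndependent_iff'.1 (hu s) _ _ (funext fun t => ?_)
    have := congrFun h (s, t)
    simp only [Finset.sum_apply, Pi.smul_apply, smul_eq_mul, Pi.zero_apply] at this ⊢
    rw [← this]
    refine Finset.sum_congr rfl fun i _ => ?_
    rw [Finset.sum_mul]
    exact Finset.sum_congr rfl fun j _ => mul_assoc _ _ _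
  rintro ⟨i, j⟩
  by_cases hb : (i, j) ∈ F
  · refine linearIndependent_iff'.1 (hw i) (F.image Prod.snd) (fun j => g (i, j))
      (funext fun s => ?_) j (Finset.mem_image_of_mem Prod.snd hb)
    simpa using h₁ s i (Finset.mem_image_of_mem Prod.fst hb)
  · exact hg _ hb

theorem linearIndependent_pi_prod {β S : Type*} (v : β → S → ℂ) (hv : LinearIndependent ℂ v)
    (n : ℕ) : LinearIndependent ℂ fun (b : Fin n → β) (s : Fin n → S) => ∏ i, v (b i) (s i) := by
  induction n with
  | zero =>
    rw [linearIndependent_unique_iff]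
    intro h
    simpa using congrFun h default
  | succ n ih =>
    rw [← linearIndependent_equiv (Fin.consEquiv fun _ => β)]
    refine LinearIndependent.of_comp
      (LinearMap.funLeft ℂ ℂ (Fin.consEquiv fun _ : Fin (n + 1) => S)) ?_
    have h := linearIndependent_nested (fun (_ : β) (b : Fin n → β) (s : Fin n → S) =>
      ∏ i, v (b i) (s i)) (fun b _ t => v b t) (fun _ => ih) fun _ => hv
    -- The nested lemma eliminates its second variable first; the swap makes that variable the head
    -- `s 0`.
    refine LinearIndependent.of_comp (LinearMap.funLeft ℂ ℂ Prod.swap) ?_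
    convert h using 1
    funext b x
    simp [LinearMap.funLeft, Fin.consEquiv, Fin.prod_univ_succ, mul_comm]

/-- Polynomials of degrees `0, 1, 2, …` are independent, and a polynomial vanishing on the infinite
range of `e` is zero; the weight `h` never vanishes and can be cancelled. -/
theorem linearIndependent_eval {S : Type*} (h e : S → ℂ) (hh : ∀ s, h s ≠ 0)
    (he : (Set.range e).Infinite) (P : ℕ → Polynomial ℂ) (hP : ∀ i, (P i).degree = i) :
    LinearIndependent ℂ fun (i : ℕ) (s : S) => h s * (P i).eval (e s) := by
  let L : Polynomial ℂ →ₗ[ℂ] S → ℂ :=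
    { toFun := fun p s => h s * p.eval (e s)
      map_add' := fun p q => funext fun s => by simp [mul_add]
      map_smul' := fun c p => funext fun s => by simp [mul_left_comm] }
  have hL : LinearMap.ker L = ⊥ := by
    refine LinearMap.ker_eq_bot'.2 fun p hp => Polynomial.eq_zero_of_infinite_isRoot p ?_
    refine he.mono ?_
    rintro _ ⟨s, rfl⟩
    exact (mul_eq_zero.1 (congrFun hp s)).resolve_left (hh s)
  exact (Polynomial.Sequence.linearIndependent ⟨P, hP⟩).map' L hL

end Independence

/-! ### The action on monomial functions -/

section Monomials

variable {n : ℕ}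

open Classical in
/-- The function `∏ x_i ^ m_i` on `regularSet n`, extended by zero. -/
def mono (m : Fin n → ℤ) : Smooth n :=
  ⟨(regularSet n).indicator fun x => ∏ i, (x i : ℂ) ^ m i, by
    have h : ContDiffOn ℝ ∞ (fun x : Fin n → ℝ => ∏ i, (x i : ℂ) ^ m i) (regularSet n) := by
      refine contDiffOn_prod fun i _ => ?_
      cases m i with
      | ofNat k => simpa using (contDiffOn_coord n i).pow k
      | negSucc k => simpa [zpow_negSucc] using (contDiffOn_coord_inv n i).pow (k + 1)
    exact h.congr fun x hx => Set.indicator_of_mem hx _,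
  fun x hx => Set.indicator_of_notMem hx _⟩

theorem mono_apply (m : Fin n → ℤ) {x : Fin n → ℝ} (hx : x ∈ regularSet n) :
    (mono m).1 x = ∏ i, (x i : ℂ) ^ m i := by
  classical
  exact Set.indicator_of_mem hx fun x => ∏ i, (x i : ℂ) ^ m i

theorem mono_add_single_apply (m : Fin n → ℤ) (i : Fin n) (k : ℤ) {x : Fin n → ℝ}
    (hx : x ∈ regularSet n) :
    (mono (m + Pi.single i k)).1 x = (x i : ℂ) ^ k * (mono m).1 x := by
  have h0 : ∀ j, (x j : ℂ) ≠ 0 := fun j => by exact_mod_cast hx j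
  rw [mono_apply _ hx, mono_apply _ hx]
  simp only [Pi.add_apply, zpow_add₀ (h0 _), Finset.prod_mul_distrib]
  rw [mul_comm, Finset.prod_eq_single i]
  · simp
  · intro j _ hj
    simp [hj]
  · simp

theorem X_mono (m : Fin n → ℤ) (i : Fin n) : X n i (mono m) = mono (m + Pi.single i 1) :=
  smooth_ext fun x hx => by rw [X_apply, mono_add_single_apply m i 1 hx, zpow_one]

theorem Xinv_mono (m : Fin n → ℤ) (i : Fin n) : Xinv n i (mono m) = mono (m + Pi.single i (-1)) :=
  smooth_ext fun x hx => by rw [Xinv_apply, mono_add_single_apply m i (-1) hx, zpow_neg_one]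

theorem D_mono (m : Fin n → ℤ) (i : Fin n) :
    D n i (mono m) = (m i : ℂ) • mono (m + Pi.single i (-1)) := by
  refine smooth_ext fun x hx => ?_
  have hn := (isOpen_regularSet n).mem_nhds hx
  have h0 : (x i : ℂ) ≠ 0 := by exact_mod_cast hx i
  -- The partial derivative is the derivative along the coordinate line through `x`, where the
  -- function is a constant times one power near `x i`.
  have hline : HasDerivAt (fun t => (mono m).1 (Function.update x i t))
      (fderiv ℝ (mono m).1 x (Pi.single i 1)) (x i) := by
    have h := (smooth_differentiableAt (mono m) hx).hasFDerivAt
    rw [← Function.update_eq_self i x] at h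
    have := h.comp_hasDerivAt (x i) (hasDerivAt_update x i (x i))
    rw [Function.update_eq_self] at this
    exact this
  have hprod : HasDerivAt (fun t : ℝ => (t : ℂ) ^ m i * ∏ j ∈ Finset.univ.erase i, (x j : ℂ) ^ m j)
      ((m i : ℂ) * (x i : ℂ) ^ (m i - 1) * ∏ j ∈ Finset.univ.erase i, (x j : ℂ) ^ m j) (x i) :=
    ((hasDerivAt_zpow (m i) (x i : ℂ) (Or.inl h0)).comp_ofReal).mul_const _
  have heq : (fun t => (mono m).1 (Function.update x i t)) =ᶠ[nhds (x i)]
      fun t : ℝ => (t : ℂ) ^ m i * ∏ j ∈ Finset.univ.erase i, (x j : ℂ) ^ m j := by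
    filter_upwards [isOpen_ne.mem_nhds (hx i)] with t ht
    have hr : Function.update x i t ∈ regularSet n := fun j => by
      by_cases hj : j = i
      · subst hj; simpa using ht
      · simpa [hj] using hx j
    rw [mono_apply _ hr, ← Finset.mul_prod_erase _ _ (Finset.mem_univ i), Function.update_self]
    congr 1
    refine Finset.prod_congr rfl fun j hj => ?_
    rw [Function.update_of_ne (Finset.ne_of_mem_erase hj)]
  have e := hline.unique (hprod.congr_of_eventuallyEq heq)
  rw [D_apply i _ hx, e]
  change _ = (m i : ℂ) * (mono (m + Pi.single i (-1))).1 x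
  rw [mono_add_single_apply m i (-1) hx, mono_apply m hx,
    ← Finset.mul_prod_erase _ _ (Finset.mem_univ i), zpow_sub_one₀ h0, zpow_neg_one]
  ring

end Monomials

/-! ### The realisation is faithful -/

section Faithful

variable {n : ℕ} (ħ : ℝ)

theorem siteRep_mul_apply (i : Fin n) (x y : Alg ħ) (a : Fin n → ℝ) (f : Smooth n) :
    siteRep ħ i (x * y) a f = siteRep ħ i x a (siteRep ħ i y a f) := by
  rw [map_mul]
  rfl

theorem siteRep_plus_mono (i : Fin n) (a : Fin n → ℝ) (m : Fin n → ℤ) :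
    siteRep ħ i (J ħ .plus) a (mono m)
      = ((1 / 2 : ℂ) * (a i - (ħ : ℂ) ^ 2 * (m i * (m i - 1)))) • mono (m + Pi.single i (-2)) := by
  rw [siteRep_J]
  have e : tripleAt ħ i .plus a (mono m) = (1 / 2 : ℂ) • (-((ħ : ℂ) ^ 2 • D n i (D n i (mono m)))
      + (a i : ℂ) • Xinv n i (Xinv n i (mono m))) := rfl
  rw [e, D_mono, map_smul, D_mono, Xinv_mono, Xinv_mono, add_assoc, ← Pi.single_add]
  simp only [Pi.add_apply, Pi.single_eq_same, Int.reduceAdd, Int.reduceNeg]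
  push_cast
  module

theorem siteRep_minus_mono (i : Fin n) (a : Fin n → ℝ) (m : Fin n → ℤ) :
    siteRep ħ i (J ħ .minus) a (mono m) = (1 / 2 : ℂ) • mono (m + Pi.single i 2) := by
  rw [siteRep_J]
  have e : tripleAt ħ i .minus a (mono m) = (1 / 2 : ℂ) • X n i (X n i (mono m)) := rfl
  rw [e, X_mono, X_mono, add_assoc, ← Pi.single_add]
  rfl

theorem siteRep_three_mono (i : Fin n) (a : Fin n → ℝ) (m : Fin n → ℤ) :
    siteRep ħ i (J ħ .three) a (mono m)
      = (-(Complex.I * (ħ : ℂ) / 2) * (m i + 1 / 2)) • mono m := by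
  rw [siteRep_J]
  have e : tripleAt ħ i .three a (mono m) = (-(Complex.I * (ħ : ℂ) / 2)) •
      (X n i (D n i (mono m)) + (1 / 2 : ℂ) • mono m) := rfl
  have z : m + Pi.single i (-1) + Pi.single i 1 = m := by
    rw [add_assoc, ← Pi.single_add]
    simp
  rw [e, D_mono, map_smul, X_mono, z]
  module

theorem siteRep_plus_pow_mono (i : Fin n) (a : Fin n → ℝ) (m : Fin n → ℤ) (r : ℕ) :
    siteRep ħ i (J ħ .plus ^ r) a (mono m)
      = (∏ l ∈ Finset.range r, (1 / 2 : ℂ) * (a i - (ħ : ℂ) ^ 2 *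
          ((m i - 2 * l) * (m i - 2 * l - 1)))) • mono (m + Pi.single i (-2 * r : ℤ)) := by
  induction r with
  | zero => simp
  | succ r ih =>
    rw [pow_succ', siteRep_mul_apply, ih, map_smul, siteRep_plus_mono, smul_smul, add_assoc,
      ← Pi.single_add, Finset.prod_range_succ]
    congr 2
    · simp only [Pi.add_apply, Pi.single_eq_same]
      push_cast
      ring
    · push_cast
      ring_nf

theorem siteRep_three_pow_mono (i : Fin n) (a : Fin n → ℝ) (m : Fin n → ℤ) (q : ℕ) :
    siteRep ħ i (J ħ .three ^ q) a (mono m)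
      = (-(Complex.I * (ħ : ℂ) / 2) * (m i + 1 / 2)) ^ q • mono m := by
  induction q with
  | zero => simp
  | succ q ih =>
    rw [pow_succ', siteRep_mul_apply, ih, map_smul, siteRep_three_mono, smul_smul, pow_succ]

theorem siteRep_minus_pow_mono (i : Fin n) (a : Fin n → ℝ) (m : Fin n → ℤ) (p : ℕ) :
    siteRep ħ i (J ħ .minus ^ p) a (mono m)
      = (1 / 2 : ℂ) ^ p • mono (m + Pi.single i (2 * p : ℤ)) := by
  induction p with
  | zero => simp
  | succ p ih =>
    rw [pow_succ', siteRep_mul_apply, ih, map_smul, siteRep_minus_mono, smul_smul, add_assoc,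
      ← Pi.single_add, pow_succ]
    push_cast
    rw [mul_add, mul_one]

/-- The coefficient with which the ordered monomial `b` acts on a monomial function of
exponent `μ`, for the value `α` of the parameter. -/
def actCoeff (b : ℕ × ℕ × ℕ) (μ : ℤ) (α : ℝ) : ℂ :=
  (1 / 2 : ℂ) ^ b.2.1 * (-(Complex.I * (ħ : ℂ) / 2) * (μ - 2 * b.1 + 1 / 2)) ^ b.2.2 *
    ∏ l ∈ Finset.range b.1, (1 / 2 : ℂ) * (α - (ħ : ℂ) ^ 2 * ((μ - 2 * l) * (μ - 2 * l - 1)))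

/-- The shift of the exponent caused by the ordered monomial `b`. -/
def actShift (b : ℕ × ℕ × ℕ) : ℤ := 2 * b.2.1 - 2 * b.1

theorem siteRep_ordMonomial_mono (i : Fin n) (a : Fin n → ℝ) (m : Fin n → ℤ) (b : ℕ × ℕ × ℕ) :
    siteRep ħ i (ordMonomial ħ b) a (mono m)
      = actCoeff ħ b (m i) (a i) • mono (m + Pi.single i (actShift b)) := by
  have hs : -2 * (b.1 : ℤ) + 2 * b.2.1 = actShift b := by
    unfold actShift
    ring
  rw [ordMonomial, siteRep_mul_apply, siteRep_mul_apply, siteRep_plus_pow_mono, map_smul,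
    siteRep_three_pow_mono, smul_smul, map_smul, siteRep_minus_pow_mono, smul_smul, add_assoc,
    ← Pi.single_add, hs]
  congr 1
  simp only [actCoeff, Pi.add_apply, Pi.single_eq_same]
  push_cast
  ring

/-- Each `T i` reads and changes only the exponent at `i`, so over a list without repetition the
coefficients depend only on the original exponents. A list is used because the operator product is
ordered. -/
theorem list_prod_mono (T : Fin n → Op n) (κ : Fin n → ℤ → ℂ) (s : Fin n → ℤ)
    (hT : ∀ i m, T i (mono m) = κ i (m i) • mono (m + Pi.single i (s i))) (l : List (Fin n))
    (hl : l.Nodup) (m : Fin n → ℤ) :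
    (l.map T).prod (mono m) = (l.map fun i => κ i (m i)).prod •
      mono (m + (l.map fun i => Pi.single i (s i)).sum) := by
  induction l with
  | nil => simp
  | cons i l ih =>
    obtain ⟨hi, hl'⟩ := List.nodup_cons.1 hl
    have h0 : (l.map fun j => (Pi.single j (s j) : Fin n → ℤ)).sum i = 0 := by
      clear ih hl hl'
      induction l with
      | nil => rfl
      | cons j l ih =>
        have hij : i ≠ j := fun e => hi (by simp [e])
        rw [List.map_cons, List.sum_cons, Pi.add_apply, ih fun h => hi (List.mem_cons_of_mem _ h),
          Pi.single_eq_of_ne hij, add_zero]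
    rw [List.map_cons, List.prod_cons, Module.End.mul_apply, ih hl', map_smul, hT, smul_smul,
      Pi.add_apply, h0, add_zero, List.map_cons, List.prod_cons, List.map_cons, List.sum_cons,
      add_assoc, mul_comm, add_comm (List.sum _)]

theorem realisation_pureTensor_mono (b : Fin n → ℕ × ℕ × ℕ) (a : Fin n → ℝ) (m : Fin n → ℤ) :
    realisation ħ n (pureTensor ħ fun i => ordMonomial ħ (b i)) a (mono m)
      = (∏ i, actCoeff ħ (b i) (m i) (a i)) • mono (m + fun i => actShift (b i)) := by
  have h := chainLift_pureTensor (B := OpFamily n) (siteRep ħ) (siteRep_commute ħ)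
    fun i => ordMonomial ħ (b i)
  have h' : realisation ħ n (pureTensor ħ fun i => ordMonomial ħ (b i)) a
      = ((List.finRange n).map fun i => siteRep ħ i (ordMonomial ħ (b i)) a).prod := by
    rw [realisation, h, List.ofFn_eq_map]
    have := map_list_prod (Pi.evalMonoidHom (fun _ : Fin n → ℝ => Op n) a)
      ((List.finRange n).map fun i => siteRep ħ i (ordMonomial ħ (b i)))
    rw [List.map_map] at this
    exact this
  rw [h', list_prod_mono _ (fun i μ => actCoeff ħ (b i) μ (a i)) (fun i => actShift (b i))
    (fun i m => siteRep_ordMonomial_mono ħ i a m (b i)) _ (List.nodup_finRange n),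
    ← List.ofFn_eq_map, ← List.ofFn_eq_map, List.prod_ofFn, List.sum_ofFn,
    Finset.univ_sum_single]

/-- The value at `ξ` of the image of the monomial function of exponent `μ` under the ordered
monomial `b`, for the value `α` of the parameter. -/
def actValue (b : ℕ × ℕ × ℕ) (s : (ℤ × {ξ : ℝ // ξ ≠ 0}) × ℝ) : ℂ :=
  actCoeff ħ b s.1.1 s.2 * ((s.1.2 : ℝ) : ℂ) ^ (s.1.1 + actShift b)

/-- The three exponents are recovered from three variables: `r` is the degree in the parameter `α`,
`p` is seen through powers of `ξ ^ 2` once `r` and `μ` are fixed, and `q` is the degree in the `J₃`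
eigenvalue, which varies with `μ`. -/
theorem linearIndependent_actValue (hħ : ħ ≠ 0) : LinearIndependent ℂ (actValue ħ) := by
  -- The part of the value free of `α`; the trivial factor `1` is the weight expected by
  -- `linearIndependent_eval`.
  let w : ℕ → ℕ × ℕ → ℤ × {ξ : ℝ // ξ ≠ 0} → ℂ := fun r b s =>
    (1 * (Polynomial.X ^ b.2 : Polynomial ℂ).eval
      (-(Complex.I * (ħ : ℂ) / 2) * (s.1 - 2 * r + 1 / 2)))
    * (((s.2 : ℝ) : ℂ) ^ (s.1 - 2 * r : ℤ) *
      (Polynomial.X ^ b.1 : Polynomial ℂ).eval ((1 / 2 : ℂ) * ((s.2 : ℝ) : ℂ) ^ 2))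
  let Q : ℤ → ℕ → Polynomial ℂ := fun μ r => ∏ l ∈ Finset.range r, Polynomial.C (1 / 2 : ℂ) *
    (Polynomial.X - Polynomial.C ((ħ : ℂ) ^ 2 * ((μ - 2 * l) * (μ - 2 * l - 1))))
  let u : ℕ → ℤ × {ξ : ℝ // ξ ≠ 0} → ℝ → ℂ := fun r s α => 1 * (Q s.1 r).eval (α : ℂ)
  have hw : ∀ r, LinearIndependent ℂ (w r) := fun r => by
    refine linearIndependent_nested
      (fun (_ : ℕ) (q : ℕ) (μ : ℤ) => 1 * (Polynomial.X ^ q : Polynomial ℂ).eval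
        (-(Complex.I * (ħ : ℂ) / 2) * (μ - 2 * r + 1 / 2)))
      (fun (p : ℕ) (μ : ℤ) (ξ : {ξ : ℝ // ξ ≠ 0}) => ((ξ : ℝ) : ℂ) ^ (μ - 2 * r : ℤ) *
        (Polynomial.X ^ p : Polynomial ℂ).eval ((1 / 2 : ℂ) * ((ξ : ℝ) : ℂ) ^ 2)) ?_ ?_
    · intro _
      refine linearIndependent_eval _ _ (fun _ => one_ne_zero) ?_ _ fun q =>
        Polynomial.degree_X_pow q
      refine Set.infinite_range_of_injective fun μ ν h => ?_
      -- Here `ħ ≠ 0` makes the `J₃` eigenvalues of distinct exponents distinct.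
      simpa [hħ] using h
    · intro μ
      refine linearIndependent_eval _ _
        (fun ξ => zpow_ne_zero _ (by exact_mod_cast ξ.2)) ?_ _ fun p => Polynomial.degree_X_pow p
      have hinf : (Set.range fun k : ℕ => (1 / 2 : ℂ) * (((k + 1 : ℕ) : ℝ) : ℂ) ^ 2).Infinite := by
        refine Set.infinite_range_of_injective fun k l h => ?_
        have h' : (((k + 1 : ℕ) : ℝ) : ℂ) ^ 2 = (((l + 1 : ℕ) : ℝ) : ℂ) ^ 2 :=
          mul_left_cancel₀ (by norm_num) h
        have h'' : (k + 1) ^ 2 = (l + 1) ^ 2 := by exact_mod_cast h'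
        have := Nat.pow_left_injective two_ne_zero h''
        omega
      refine hinf.mono ?_
      rintro _ ⟨k, rfl⟩
      exact ⟨⟨((k + 1 : ℕ) : ℝ), by positivity⟩, rfl⟩
  have hu : ∀ s, LinearIndependent ℂ fun r => u r s := fun s => by
    refine linearIndependent_eval _ _ (fun _ => one_ne_zero)
      (Set.infinite_range_of_injective Complex.ofReal_injective) _ fun r => ?_
    simp only [Q]
    rw [Polynomial.degree_prod, Finset.sum_congr rfl fun l _ => by
      rw [Polynomial.degree_C_mul (by norm_num), Polynomial.degree_X_sub_C]]
    simp
  convert linearIndependent_nested w u hw hu using 1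
  funext b s
  obtain ⟨r, p, q⟩ := b
  obtain ⟨⟨μ, ξ⟩, α⟩ := s
  have h0 : ((ξ : ℝ) : ℂ) ≠ 0 := by exact_mod_cast ξ.2
  have hz : ((ξ : ℝ) : ℂ) ^ (μ + (2 * p - 2 * r) : ℤ)
      = ((ξ : ℝ) : ℂ) ^ (μ - 2 * r : ℤ) * (((ξ : ℝ) : ℂ) ^ 2) ^ p := by
    rw [← pow_mul, ← zpow_natCast, ← zpow_add₀ h0]
    congr 1
    push_cast
    ring
  simp only [actValue, actCoeff, actShift, w, u, Q, hz, Polynomial.eval_prod, Polynomial.eval_mul,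
    Polynomial.eval_C, Polynomial.eval_sub, Polynomial.eval_X, Polynomial.eval_pow, mul_pow]
  ring

/-- The values at `x` of the images of the monomial functions. -/
def evalFamily (n : ℕ) :
    OpFamily n →ₗ[ℂ] (Fin n → (ℤ × {ξ : ℝ // ξ ≠ 0}) × ℝ) → ℂ where
  toFun T s := (T (fun i => (s i).2) (mono fun i => (s i).1.1)).1 fun i => (s i).1.2
  map_add' _ _ := rfl
  map_smul' _ _ := rfl

/-- A linear map that sends a spanning family to an independent one is injective. The spanning
family is that of pure tensors of ordered monomials; the values of their images factor over the
sites, so independence reduces to one site. -/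
theorem realisation_injective (hħ : ħ ≠ 0) (n : ℕ) : Function.Injective (realisation ħ n) := by
  have h : Function.Injective ((evalFamily n).comp (realisation ħ n).toLinearMap) := by
    refine LinearMap.injective_of_linearIndependent (span_pureTensor_ordMonomial ħ n) ?_
    suffices hv : (fun (b : Fin n → ℕ × ℕ × ℕ) s => ∏ i, actValue ħ (b i) (s i))
        = (evalFamily n).comp (realisation ħ n).toLinearMap ∘
          fun b => pureTensor ħ fun i => ordMonomial ħ (b i) by
      rw [← hv]
      exact linearIndependent_pi_prod _ (linearIndependent_actValue ħ hħ) n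
    funext b s
    have hx : (fun i => ((s i).1.2 : ℝ)) ∈ regularSet n := fun i => (s i).1.2.2
    have e : evalFamily n (realisation ħ n (pureTensor ħ fun i => ordMonomial ħ (b i))) s
        = (∏ i, actCoeff ħ (b i) (s i).1.1 (s i).2) *
          (mono ((fun i => (s i).1.1) + fun i => actShift (b i))).1 fun i => (s i).1.2 :=
      congrArg (fun f : Smooth n => f.1 fun i => (s i).1.2)
        (realisation_pureTensor_mono ħ b (fun i => (s i).2) fun i => (s i).1.1)
    refine Eq.trans ?_ e.symm
    rw [mono_apply _ hx, ← Finset.prod_mul_distrib]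
    rfl
  intro x y hxy
  exact h (congrArg (evalFamily n) hxy)

end Faithful

/-! ### The substructures -/

section Substructure

variable {n k : ℕ} (ħ : ℝ)

theorem block_zero : block n k 0 = Finset.univ.filter fun i : Fin n => i.val + 1 < k := rfl

theorem block_one : block n k 1 = Finset.univ.filter fun i : Fin n => i.val + 1 = k := rfl

theorem block_two : block n k 2 = Finset.univ.filter fun i : Fin n => k < i.val + 1 := rfl

theorem block_disjoint (p q : Fin 3) (h : p ≠ q) : Disjoint (block n k p) (block n k q) := by
  rw [Finset.disjoint_left]
  intro i hp hq
  fin_cases p <;> fin_cases q <;>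
    simp [block_zero, block_one, block_two] at h hp hq <;> omega

theorem block_nonempty (hk : 2 ≤ k) (hk' : k ≤ n - 1) (q : Fin 3) : (block n k q).Nonempty := by
  fin_cases q
  · exact ⟨⟨0, by omega⟩, by simp [block_zero]; omega⟩
  · exact ⟨⟨k - 1, by omega⟩, by simp [block_one]; omega⟩
  · exact ⟨⟨n - 1, by omega⟩, by simp [block_two]; omega⟩

/-- The morphism `θ` between Racah algebras. -/
def theta (hne : ∀ q, (block n k q).Nonempty) : racah ħ 3 →ₐ[ℂ] racah ħ n :=
  ((blockHom (block n k) block_disjoint ħ).comp (racah ħ 3).val).codRestrict (racah ħ n) <| by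
    rintro ⟨x, hx⟩
    change blockHom (block n k) block_disjoint ħ x ∈ racah ħ n
    have h : (racah ħ 3).map (blockHom (block n k) block_disjoint ħ) ≤ racah ħ n := by
      rw [racah, AlgHom.map_adjoin]
      refine Algebra.adjoin_le ?_
      rintro _ ⟨_, ⟨B, hB, rfl⟩, rfl⟩
      rw [blockHom_casimirOn]
      exact Algebra.subset_adjoin ⟨_, hB.biUnion fun q _ => hne q, rfl⟩
    exact h ⟨x, hx, rfl⟩

theorem theta_coe (hne : ∀ q, (block n k q).Nonempty) (x : racah ħ 3) :
    (theta ħ hne x : Chain ħ n) = blockHom (block n k) block_disjoint ħ x := rfl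

theorem theta_injective (hne : ∀ q, (block n k q).Nonempty) :
    Function.Injective (theta ħ hne) := fun _ _ h =>
  Subtype.ext (blockHom_injective (block n k) block_disjoint hne (congrArg Subtype.val h))

theorem theta_racahGen (hne : ∀ q, (block n k q).Nonempty) (B : Finset (Fin 3))
    (hB : B.Nonempty) :
    (theta ħ hne (racahGen ħ 3 B hB) : Chain ħ n) = casimirOn ħ n (B.biUnion (block n k)) := by
  rw [theta_coe]
  exact blockHom_casimirOn _ _ B

/-- The realisation of the iterated coproduct on the sites in `A`. -/
def tripleOn (A : Finset (Fin n)) : Gen → OpFamily n := ∑ i ∈ A, tripleAt ħ i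

theorem slTriple_tripleOn (A : Finset (Fin n)) : SlTriple ħ (tripleOn ħ A) := by
  have h := (slTriple_J ħ).map (B' := OpFamily n) ((realisation ħ n).comp (coproduct ħ n A))
  have e : (fun σ => ((realisation ħ n).comp (coproduct ħ n A)) (J ħ σ)) = tripleOn ħ A :=
    funext fun σ => realisation_coproduct_J ħ A σ
  rw [← e]
  exact h

theorem tripleOn_commute {A A' : Finset (Fin n)} (h : Disjoint A A') (σ τ : Gen) :
    Commute (tripleOn ħ A σ) (tripleOn ħ A' τ) := by
  have h' := (coproduct_commute ħ n h (J ħ σ) (J ħ τ)).map (realisation ħ n)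
  rw [realisation_coproduct_J, realisation_coproduct_J] at h'
  exact h'

theorem tripleOn_union {A A' : Finset (Fin n)} (h : Disjoint A A') :
    tripleOn ħ A + tripleOn ħ A' = tripleOn ħ (A ∪ A') := (Finset.sum_union h).symm

theorem racahRelations_tripleOn (hħ : ħ ≠ 0) {A₁ A₂ A₃ : Finset (Fin n)} (h₁₂ : Disjoint A₁ A₂)
    (h₁₃ : Disjoint A₁ A₃) (h₂₃ : Disjoint A₂ A₃) :
    RacahRelations ħ (casOf (tripleOn ħ A₁)) (casOf (tripleOn ħ A₂)) (casOf (tripleOn ħ A₃))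
      (casOf (tripleOn ħ (A₁ ∪ A₂))) (casOf (tripleOn ħ (A₂ ∪ A₃)))
      (casOf (tripleOn ħ (A₁ ∪ A₃))) (casOf (tripleOn ħ (A₁ ∪ A₂ ∪ A₃)))
      ((1 / (2 * Complex.I * (ħ : ℂ))) •
        comm (casOf (tripleOn ħ (A₁ ∪ A₂))) (casOf (tripleOn ħ (A₂ ∪ A₃)))) := by
  have h := racahRelations_casOf (B := OpFamily n) hħ (slTriple_tripleOn ħ A₁)
    (slTriple_tripleOn ħ A₂) (slTriple_tripleOn ħ A₃) (tripleOn_commute ħ h₁₂)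
    (tripleOn_commute ħ h₁₃) (tripleOn_commute ħ h₂₃)
  rwa [tripleOn_union ħ h₁₂, tripleOn_union ħ h₂₃, tripleOn_union ħ h₁₃,
    tripleOn_union ħ (Finset.disjoint_union_left.2 ⟨h₁₃, h₂₃⟩)] at h

theorem leftCas_pred_eq (hk : 1 ≤ k) (hk' : k ≤ n) :
    leftCas ħ n (k - 1) = casOf (tripleOn ħ (block n k 0)) := by
  rw [leftCas_eq ħ (by omega), tripleOn, block_zero]
  congr 2
  exact Finset.filter_congr fun i _ => by omega

theorem siteCas_eq_block (hk : 1 ≤ k) (hk' : k ≤ n) :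
    siteCas ħ n k = casOf (tripleOn ħ (block n k 1)) := siteCas_eq ħ hk hk'

theorem rightCas_succ_eq (hk' : k ≤ n) :
    rightCas ħ n (k + 1) = casOf (tripleOn ħ (block n k 2)) :=
  rightCas_eq ħ (by omega) (by omega)

theorem leftCas_eq_block (hk' : k ≤ n) :
    leftCas ħ n k = casOf (tripleOn ħ (block n k 0 ∪ block n k 1)) := by
  rw [leftCas_eq ħ hk', tripleOn, block_zero, block_one, ← Finset.filter_or]
  congr 2
  exact Finset.filter_congr fun i _ => by omega

theorem rightCas_eq_block (hk : 1 ≤ k) (hk' : k ≤ n) :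
    rightCas ħ n k = casOf (tripleOn ħ (block n k 1 ∪ block n k 2)) := by
  rw [rightCas_eq ħ hk (by omega), tripleOn, block_one, block_two, ← Finset.filter_or]
  congr 2
  exact Finset.filter_congr fun i _ => by omega

theorem leftCas_total_eq :
    leftCas ħ n n = casOf (tripleOn ħ (block n k 0 ∪ block n k 1 ∪ block n k 2)) := by
  rw [leftCas_eq ħ le_rfl, tripleOn, block_zero, block_one, block_two, ← Finset.filter_or,
    ← Finset.filter_or]
  congr 2
  exact Finset.filter_congr fun i _ => by omega

theorem leftCas_total_eq_rightCas : leftCas ħ n n = rightCas ħ n 1 := by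
  rw [leftCas_eq ħ le_rfl, rightCas_eq ħ le_rfl (by omega)]
  congr 2
  exact Finset.filter_congr fun i _ => by omega

/-- The combination defining `midCas` is the linear Racah relation solved for the Casimir of the two
outer blocks, which are not adjacent in the chain. -/
theorem midCas_eq (hħ : ħ ≠ 0) (hk : 1 ≤ k) (hk' : k ≤ n) :
    midCas ħ n k = casOf (tripleOn ħ (block n k 0 ∪ block n k 2)) := by
  rw [midCas, leftCas_pred_eq ħ hk hk', siteCas_eq_block ħ hk hk', rightCas_succ_eq ħ hk',
    leftCas_eq_block ħ hk', rightCas_eq_block ħ hk hk', leftCas_total_eq (k := k) ħ,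
    (racahRelations_tripleOn ħ hħ (block_disjoint 0 1 (by decide))
      (block_disjoint 0 2 (by decide)) (block_disjoint 1 2 (by decide))).linear]
  abel

theorem realisation_theta (hne : ∀ q, (block n k q).Nonempty) (B : Finset (Fin 3))
    (hB : B.Nonempty) :
    realisation ħ n (theta ħ hne (racahGen ħ 3 B hB))
      = casOf (tripleOn ħ (B.biUnion (block n k))) := by
  rw [theta_racahGen, realisation_casimirOn, tripleOn]

theorem theta_range_map (hne : ∀ q, (block n k q).Nonempty) :
    ((theta ħ hne).range.map (racah ħ n).val).map (realisation ħ n)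
      = Algebra.adjoin ℂ {c | ∃ B : Finset (Fin 3), B.Nonempty ∧
          c = casOf (tripleOn ħ (B.biUnion (block n k)))} := by
  have h : (theta ħ hne).range.map (racah ħ n).val
      = (racah ħ 3).map (blockHom (block n k) block_disjoint ħ) := by
    ext x
    constructor
    · rintro ⟨_, ⟨y, rfl⟩, rfl⟩
      exact ⟨y, y.2, rfl⟩
    · rintro ⟨y, hy, rfl⟩
      exact ⟨_, ⟨⟨y, hy⟩, rfl⟩, rfl⟩
  rw [h, racah, AlgHom.map_adjoin, AlgHom.map_adjoin]
  congr 1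
  ext c
  constructor
  · rintro ⟨_, ⟨_, ⟨B, hB, rfl⟩, rfl⟩, rfl⟩
    refine ⟨B, hB, ?_⟩
    rw [blockHom_casimirOn, realisation_casimirOn, tripleOn]
  · rintro ⟨B, hB, rfl⟩
    refine ⟨_, ⟨_, ⟨B, hB, rfl⟩, rfl⟩, ?_⟩
    rw [blockHom_casimirOn, realisation_casimirOn, tripleOn]

theorem setOf_nonempty_finset_three {α : Type*} (f : Finset (Fin 3) → α) :
    {c | ∃ B : Finset (Fin 3), B.Nonempty ∧ c = f B}
      = {f {0}, f {1}, f {2}, f {0, 1}, f {1, 2}, f {0, 2}, f {0, 1, 2}} := by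
  have key : ∀ B : Finset (Fin 3), B.Nonempty → B = {0} ∨ B = {1} ∨ B = {2} ∨ B = {0, 1} ∨
      -- A finite check over the eight subsets of a three-element set.
      B = {1, 2} ∨ B = {0, 2} ∨ B = {0, 1, 2} := by decide
  ext c
  simp only [Set.mem_ofPred_eq, Set.mem_insert_iff, Set.mem_singleton_iff]
  constructor
  · rintro ⟨B, hB, rfl⟩
    rcases key B hB with rfl | rfl | rfl | rfl | rfl | rfl | rfl <;> simp
  · rintro (h | h | h | h | h | h | h) <;> exact ⟨_, by simp, h⟩

end Substructure

end RacahSub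

end

open RacahSub in
theorem proposition2 (ħ : ℝ) (hħ : ħ ≠ 0) (n : ℕ) (hn : 3 < n) :
    -- the differential realisation of the chain of `n` sites
    ∃ ρ : Chain ħ n →ₐ[ℂ] OpFamily n, IsRealisation ħ n ρ ∧
    ∀ k : ℕ, 2 ≤ k → k ≤ n - 1 →
      -- the injective morphism `θ_k`, with `C_B ↦ C_{K_B}`
      ∃ θ : racah ħ 3 →ₐ[ℂ] racah ħ n, Function.Injective θ ∧
        (∀ (B : Finset (Fin 3)) (hB : B.Nonempty),
          (θ (racahGen ħ 3 B hB) : Chain ħ n) = casimirOn ħ n (B.biUnion (block n k))) ∧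
        -- the images of the generators, as differential operators
        ρ (θ (racahGen ħ 3 {0} (by simp))) = leftCas ħ n (k - 1) ∧
        ρ (θ (racahGen ħ 3 {1} (by simp))) = siteCas ħ n k ∧
        ρ (θ (racahGen ħ 3 {2} (by simp))) = rightCas ħ n (k + 1) ∧
        ρ (θ (racahGen ħ 3 {0, 1} (by simp))) = leftCas ħ n k ∧
        ρ (θ (racahGen ħ 3 {1, 2} (by simp))) = rightCas ħ n k ∧
        ρ (θ (racahGen ħ 3 {0, 2} (by simp))) = midCas ħ n k ∧
        ρ (θ (racahGen ħ 3 {0, 1, 2} (by simp))) = leftCas ħ n n ∧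
        leftCas ħ n n = rightCas ħ n 1 ∧
        -- the image of `θ_k` is the substructure
        (θ.range.map (racah ħ n).val).map ρ = substructure ħ n k ∧
        -- the commutation relations
        RacahRelations ħ (leftCas ħ n (k - 1)) (siteCas ħ n k) (rightCas ħ n (k + 1))
          (leftCas ħ n k) (rightCas ħ n k) (midCas ħ n k) (leftCas ħ n n)
          ((1 / (2 * Complex.I * (ħ : ℂ))) • comm (leftCas ħ n k) (rightCas ħ n k)) ∧
        -- the isomorphism with `R(3)`
        ∃ Φ : racah ħ 3 ≃ₐ[ℂ] substructure ħ n k,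
          ∀ x : racah ħ 3, (Φ x : OpFamily n) = ρ (θ x) := by
  refine ⟨realisation ħ n, isRealisation_realisation ħ n, fun k hk hk' => ?_⟩
  have hne := block_nonempty hk hk'
  have hk₁ : 1 ≤ k := by omega
  have hkn : k ≤ n := by omega
  have b₀ : ({0} : Finset (Fin 3)).biUnion (block n k) = block n k 0 := by simp
  have b₁ : ({1} : Finset (Fin 3)).biUnion (block n k) = block n k 1 := by simp
  have b₂ : ({2} : Finset (Fin 3)).biUnion (block n k) = block n k 2 := by simp
  have b₀₁ : ({0, 1} : Finset (Fin 3)).biUnion (block n k) = block n k 0 ∪ block n k 1 := by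
    simp [Finset.biUnion_insert]
  have b₁₂ : ({1, 2} : Finset (Fin 3)).biUnion (block n k) = block n k 1 ∪ block n k 2 := by
    simp [Finset.biUnion_insert]
  have b₀₂ : ({0, 2} : Finset (Fin 3)).biUnion (block n k) = block n k 0 ∪ block n k 2 := by
    simp [Finset.biUnion_insert]
  have b₀₁₂ : ({0, 1, 2} : Finset (Fin 3)).biUnion (block n k)
      = block n k 0 ∪ block n k 1 ∪ block n k 2 := by
    simp [Finset.biUnion_insert, Finset.union_assoc]
  have e₀ := leftCas_pred_eq (n := n) ħ hk₁ hkn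
  have e₁ := siteCas_eq_block (n := n) ħ hk₁ hkn
  have e₂ := rightCas_succ_eq (n := n) ħ hkn
  have e₀₁ := leftCas_eq_block (n := n) ħ hkn
  have e₁₂ := rightCas_eq_block (n := n) ħ hk₁ hkn
  have e₀₂ := midCas_eq (n := n) ħ hħ hk₁ hkn
  have e₀₁₂ := leftCas_total_eq (n := n) (k := k) ħ
  have hrange : ((theta ħ hne).range.map (racah ħ n).val).map (realisation ħ n)
      = substructure ħ n k := by
    rw [theta_range_map, setOf_nonempty_finset_three, b₀, b₁, b₂, b₀₁, b₁₂, b₀₂, b₀₁₂, ← e₀, ← e₁,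
      ← e₂, ← e₀₁, ← e₁₂, ← e₀₂, ← e₀₁₂, substructure]
  refine ⟨theta ħ hne, theta_injective ħ hne, theta_racahGen ħ hne, ?_, ?_, ?_, ?_, ?_, ?_, ?_,
    leftCas_total_eq_rightCas ħ, hrange, ?_, ?_⟩
  · rw [realisation_theta, b₀, e₀]
  · rw [realisation_theta, b₁, e₁]
  · rw [realisation_theta, b₂, e₂]
  · rw [realisation_theta, b₀₁, e₀₁]
  · rw [realisation_theta, b₁₂, e₁₂]
  · rw [realisation_theta, b₀₂, e₀₂]
  · rw [realisation_theta, b₀₁₂, e₀₁₂]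
  · rw [e₀, e₁, e₂, e₀₁, e₁₂, e₀₂, e₀₁₂]
    exact racahRelations_tripleOn ħ hħ (block_disjoint 0 1 (by decide))
      (block_disjoint 0 2 (by decide)) (block_disjoint 1 2 (by decide))
  · let f : racah ħ 3 →ₐ[ℂ] OpFamily n :=
      (realisation ħ n).comp ((racah ħ n).val.comp (theta ħ hne))
    -- Injectivity on `R(3)` needs no presentation of it: `theta` is injective, and so is the
    -- realisation on the whole chain.
    have hf : Function.Injective f := fun x y h =>
      theta_injective ħ hne (Subtype.ext (realisation_injective ħ hħ n h))
    have hfr : f.range = substructure ħ n k := by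
      rw [← hrange, AlgHom.range_comp, AlgHom.range_comp]
    exact ⟨(AlgEquiv.ofInjective f hf).trans (Subalgebra.equivOfEq _ _ hfr), fun x => rfl⟩
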